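/- **Setting.** Let $n\ge 2$, $\mathbb R^n_+=\{x: x_i\ge 0\ \forall i\}$, $\mathbb R^n_{++}=\{x: x_i>0\ \forall i\}$. Let $L,N$ be linear operators on $\mathbb R^n$, $A=\mathrm{diag}(A_1,\dots,A_n)$ with $A_i>0$, $p_i>0$ ($i=1,\dots,n$), $\rho>0$, $\gamma>0$. Assume: * $e^{tL}(\mathbb R^n_+)\subseteq\mathbb R^n_+$ for all $t\ge 0$; $N(\mathbb R^n_+)\subseteq\mathbb R^n_+$ and $Ne_i\ne 0$ for all $i$; * $(L+A)^T$ has an eigenvector $b^\star\in\mathbb R^n_{++}$ with eigenvalue $\lambda_\star>0$, and $\rho>\lambda_\star(1-\gamma)$. For $k\in\mathbb R^n_+$ let $\mathcal A_+(k)$ be the set of $C\in L^1_{loc}([0,\infty);\mathbb R^n_+)$ such that the solution $K^{k,C}$ of $K'=(L+A)K-NC$, $K(0)=k$, satisfies $K^{k,C}(t)\in\mathbb R^n_+$ for all $t\ge0$; let $\mathcal A_-(k)$ be the set of $C\in L^1_{loc}((-\infty,0];\mathbb R^n_+)$ such that the solution of the same problem backward in time satisfies $K^{k,C}(t)\in\mathbb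 R^n_+$ for all $t\le 0$. Let $u_\gamma(x)=\frac{x^{1-\gamma}}{1-\gamma}$ if $\gamma\neq1$, $u_1=\log$ (with $u_\gamma(0)=-\infty$ if $\gamma\ge1$), $U_\gamma(c)=\sum_i p_iu_\gamma(c_i)$, and $$V(k)=\sup_{C\in\mathcal A_+(k)}\int_0^\infty e^{-\rho t}U_\gamma(C(t))\,dt\in[-\infty,+\infty],\quad k\in\mathbb R^n_+ .$$ If $\gamma>1$, assume moreover that $V$ is not identically $-\infty$ on $\mathbb R^n_+$. Put $H_\gamma(q)=\sup_{c\in\mathbb R^n_+}\{-\langle Nc,q\rangle+U_\gamma(c)\}\in(-\infty,+\infty]$ and, for $k\in\partial\mathbb R^n_+$, $H_{\rm in}(k,q)=\sup_{c\in\mathcal U(k)}\{-\langle Nc,q\rangle+U_\gamma(c)\}$ (with $\sup\emptyset=-\infty$), where $\mathcal U(k)$ is the set of $c\in\mathbb R^n_+$ for which there are $C\in\mathcal A_-(k)$ and $\tau>0$ with $C(t)=c$ for all $t\in(-\tau,0]$. For $k\in\mathbb R^n_+$ with $V(k)$ finite let $$D^+V(k)=\Big\{q\in\mathbb R^n:\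 \limsup_{x\to k,\ x\in\mathbb R^n_+}\frac{V(x)-V(k)-\langle q,x-k\rangle}{\|x-k\|}\le 0\Big\},$$ and $D^+V(k)=\emptyset$ if $V(k)$ is infinite. A function $v\in C(\mathbb R^n_{++})$ is a viscosity subsolution (supersolution) of $F(k,v(k),Dv(k))=0$ in $\mathbb R^n_{++}$ if $F(k,v(k),D\phi(k))\le0$ ($\ge0$) for every $\phi\in C^1(\mathbb R^n_{++})$ and every local maximum (minimum) point $k\in\mathbb R^n_{++}$ of $v-\phi$; it is a viscosity solution if it is both. It is a bilateral viscosity solution of the HJB equation $\rho v(k)-\langle(L+A)k,Dv(k)\rangle-H_\gamma(Dv(k))=0$ if it is a viscosity solution both of this equation and of $-\rho v(k)+\langle(L+A)k,Dv(k)\rangle+H_\gamma(Dv(k))=0$. **Theorem.** $V$ is finite on $\mathbb R^n_{++}$ and is a bilateral viscosity solution of the HJB equation in $\mathbb R^n_{++}$; moreover $$\rho V(k)=\langle(L+A)k,q\rangle+H_\gamma(q)\qquad\forall\,k\in\mathbb R^n_{++},\ q\in D^+V(k),$$ and, for all $k\in\partial\mathbb R^n_+$ and $q\in D^+V(k)$,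 $$\rho V(k)-\langle(L+A)k,q\rangle-H_\gamma(q)\le0,\qquad -\rho V(k)+\langle(L+A)k,q\rangle+H_{\rm in}(k,q)\le0 .$$ -/

import Mathlib

open MeasureTheory Set Filter Topology
open scoped InnerProductSpace Gradient

noncomputable section

/-- The closed positive orthant `ℝⁿ₊`. -/
def closedOrthant (n : ℕ) : Set (EuclideanSpace ℝ (Fin n)) := {x | ∀ i, 0 ≤ x i}

/-- The open (strictly) positive orthant `ℝⁿ₊₊`. -/
def openOrthant (n : ℕ) : Set (EuclideanSpace ℝ (Fin n)) := {x | ∀ i, 0 < x i}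

/-- The integral `∫_{[0,∞)} f dt` of an extended real valued function: the integral of the positive
part minus the integral of the negative part. -/
def integralNonneg (f : ℝ → EReal) : EReal :=
  ((∫⁻ t in Ici (0 : ℝ), (f t).toENNReal : ENNReal) : EReal)
    - ((∫⁻ t in Ici (0 : ℝ), (-f t).toENNReal : ENNReal) : EReal)

/-- The utility function `u_γ : [0,∞) → ℝ ∪ {-∞}`: `x ^ (1 - γ) / (1 - γ)` if `γ ≠ 1` and `log x`
if `γ = 1`, with `u_γ(0) = -∞` if `γ ≥ 1` (and `u_γ(0) = 0` if `γ < 1`). -/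
def utility (γ x : ℝ) : EReal :=
  if 1 ≤ γ ∧ x = 0 then ⊥
  else if γ = 1 then ((Real.log x : ℝ) : EReal)
  else ((x ^ (1 - γ) / (1 - γ) : ℝ) : EReal)

/-- The superdifferential at `k` of an extended real valued function `v` on `S`, at points where
`v` is finite (it is empty at the points where `v` is infinite). -/
def superdifferential {n : ℕ} (S : Set (EuclideanSpace ℝ (Fin n)))
    (v : EuclideanSpace ℝ (Fin n) → EReal) (k : EuclideanSpace ℝ (Fin n)) :
    Set (EuclideanSpace ℝ (Fin n)) :=
  {q | v k ≠ ⊥ ∧ v k ≠ ⊤ ∧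
    limsup (fun x => (v x - v k - ((⟪q, x - k⟫_ℝ : ℝ) : EReal)) / ((‖x - k‖ : ℝ) : EReal))
      (𝓝[S \ {k}] k) ≤ 0}

section Viscosity

variable {n : ℕ}

/-- `v ∈ C(Ω)` is a viscosity subsolution of `F(k, v(k), Dv(k)) = 0` in the open set `Ω`. -/
def IsViscositySubsolution
    (F : EuclideanSpace ℝ (Fin n) → ℝ → EuclideanSpace ℝ (Fin n) → EReal)
    (Ω : Set (EuclideanSpace ℝ (Fin n))) (v : EuclideanSpace ℝ (Fin n) → ℝ) : Prop :=
  ContinuousOn v Ω ∧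
    ∀ φ : EuclideanSpace ℝ (Fin n) → ℝ, ContDiffOn ℝ 1 φ Ω →
      ∀ k ∈ Ω, IsLocalMax (fun x => v x - φ x) k → F k (v k) (∇ φ k) ≤ 0

/-- `v ∈ C(Ω)` is a viscosity supersolution of `F(k, v(k), Dv(k)) = 0` in the open set `Ω`. -/
def IsViscositySupersolution
    (F : EuclideanSpace ℝ (Fin n) → ℝ → EuclideanSpace ℝ (Fin n) → EReal)
    (Ω : Set (EuclideanSpace ℝ (Fin n))) (v : EuclideanSpace ℝ (Fin n) → ℝ) : Prop :=
  ContinuousOn v Ω ∧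
    ∀ φ : EuclideanSpace ℝ (Fin n) → ℝ, ContDiffOn ℝ 1 φ Ω →
      ∀ k ∈ Ω, IsLocalMin (fun x => v x - φ x) k → 0 ≤ F k (v k) (∇ φ k)

/-- Viscosity solution of `F(k, v(k), Dv(k)) = 0` in `Ω`. -/
def IsViscositySolution
    (F : EuclideanSpace ℝ (Fin n) → ℝ → EuclideanSpace ℝ (Fin n) → EReal)
    (Ω : Set (EuclideanSpace ℝ (Fin n))) (v : EuclideanSpace ℝ (Fin n) → ℝ) : Prop :=
  IsViscositySubsolution F Ω v ∧ IsViscositySupersolution F Ω v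

end Viscosity

/-- The data of the model: capital mobility `L`, technological levels `A`, the impact `N` of
consumption, the weights `p`, the discount factor `ρ` and the utility parameter `γ`. -/
structure GrowthModel (n : ℕ) where
  L : EuclideanSpace ℝ (Fin n) →L[ℝ] EuclideanSpace ℝ (Fin n)
  A : Fin n → ℝ
  N : EuclideanSpace ℝ (Fin n) →L[ℝ] EuclideanSpace ℝ (Fin n)
  p : Fin n → ℝ
  ρ : ℝ
  γ : ℝ

namespace GrowthModel

variable {n : ℕ} (M : GrowthModel n)

/-- The operator `L + A`, where `A = diag(A₁, …, Aₙ)`. -/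
def drift : EuclideanSpace ℝ (Fin n) →L[ℝ] EuclideanSpace ℝ (Fin n) :=
  M.L + Matrix.toEuclideanCLM (n := Fin n) (𝕜 := ℝ) (Matrix.diagonal M.A)

/-- `K` solves `K' = (L + A) K - N C`, `K(0) = k`, on the interval `S ∋ 0`, in the sense of
Carathéodory (the equation holds in integrated form). -/
def IsCapitalPath (S : Set ℝ) (k : EuclideanSpace ℝ (Fin n))
    (C K : ℝ → EuclideanSpace ℝ (Fin n)) : Prop :=
  ContinuousOn K S ∧ ∀ t ∈ S, K t = k + ∫ s in (0 : ℝ)..t, (M.drift (K s) - M.N (C s))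

/-- The controls on the time interval `S` that are locally integrable, non-negative, and whose
state path (which is unique on `S`) stays in the closed orthant. -/
def admissibleOn (S : Set ℝ) (k : EuclideanSpace ℝ (Fin n)) :
    Set (ℝ → EuclideanSpace ℝ (Fin n)) :=
  {C | LocallyIntegrableOn C S ∧ (∀ t ∈ S, C t ∈ closedOrthant n) ∧
    ∃ K : ℝ → EuclideanSpace ℝ (Fin n),
      M.IsCapitalPath S k C K ∧ ∀ t ∈ S, K t ∈ closedOrthant n}

/-- The admissible controls `𝒜₊(k)` on `[0,∞)`. -/
def admissible (k : EuclideanSpace ℝ (Fin n)) : Set (ℝ → EuclideanSpace ℝ (Fin n)) :=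
  M.admissibleOn (Ici 0) k

/-- The admissible controls `𝒜₋(k)` on `(-∞,0]`, for the backward trajectories. -/
def admissibleBackward (k : EuclideanSpace ℝ (Fin n)) : Set (ℝ → EuclideanSpace ℝ (Fin n)) :=
  M.admissibleOn (Iic 0) k

/-- The aggregate utility `U_γ(c) = ∑ᵢ pᵢ u_γ(cᵢ)`. -/
def aggregateUtility (c : EuclideanSpace ℝ (Fin n)) : EReal :=
  ∑ i, (M.p i : EReal) * utility M.γ (c i)

/-- The gain functional `J(C) = ∫₀^∞ e^{-ρt} U_γ(C(t)) dt`. -/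
def gain (C : ℝ → EuclideanSpace ℝ (Fin n)) : EReal :=
  integralNonneg fun t => ((Real.exp (-M.ρ * t) : ℝ) : EReal) * M.aggregateUtility (C t)

/-- The value function `V(k) = sup_{C ∈ 𝒜₊(k)} J(C)`. -/
def value (k : EuclideanSpace ℝ (Fin n)) : EReal :=
  ⨆ C ∈ M.admissible k, M.gain C

/-- The Hamiltonian `H_γ(q) = sup_{c ∈ ℝⁿ₊} (-⟨Nc, q⟩ + U_γ(c))`. -/
def hamiltonian (q : EuclideanSpace ℝ (Fin n)) : EReal :=
  ⨆ c ∈ closedOrthant n, ((-⟪M.N c, q⟫_ℝ : ℝ) : EReal) + M.aggregateUtility c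

/-- The set `𝒰(k)` of consumption vectors that can be held constant on some `(-τ, 0]` by a control
in `𝒜₋(k)`. -/
def inwardControls (k : EuclideanSpace ℝ (Fin n)) : Set (EuclideanSpace ℝ (Fin n)) :=
  {c | c ∈ closedOrthant n ∧
    ∃ C ∈ M.admissibleBackward k, ∃ τ > (0 : ℝ), ∀ t ∈ Ioc (-τ) 0, C t = c}

/-- The inward Hamiltonian `H_in(k, q) = sup_{c ∈ 𝒰(k)} (-⟨Nc, q⟩ + U_γ(c))`. -/
def inwardHamiltonian (k q : EuclideanSpace ℝ (Fin n)) : EReal :=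
  ⨆ c ∈ M.inwardControls k, ((-⟪M.N c, q⟫_ℝ : ℝ) : EReal) + M.aggregateUtility c

/-- The HJB operator: the equation is `ρ v - ⟨(L + A) k, Dv⟩ - H_γ(Dv) = 0`. -/
def hjb (k : EuclideanSpace ℝ (Fin n)) (r : ℝ) (q : EuclideanSpace ℝ (Fin n)) : EReal :=
  ((M.ρ * r - ⟪M.drift k, q⟫_ℝ : ℝ) : EReal) - M.hamiltonian q

/-- The opposite HJB operator: the equation is `-ρ v + ⟨(L + A) k, Dv⟩ + H_γ(Dv) = 0`. -/
def oppositeHjb (k : EuclideanSpace ℝ (Fin n)) (r : ℝ) (q : EuclideanSpace ℝ (Fin n)) : EReal :=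
  ((-(M.ρ * r) + ⟪M.drift k, q⟫_ℝ : ℝ) : EReal) + M.hamiltonian q

/-- A bilateral viscosity solution of the HJB equation in `ℝⁿ₊₊`: a viscosity solution both of the
equation and of its opposite. -/
def IsBilateralViscositySolution (v : EuclideanSpace ℝ (Fin n) → ℝ) : Prop :=
  IsViscositySolution M.hjb (openOrthant n) v ∧
    IsViscositySolution M.oppositeHjb (openOrthant n) v

end GrowthModel

end

/-! Put `B = L + A`. Convex combinations of admissible controls are admissible for the combined
initial states, and the utility is concave, so `V` is concave. Concavity makes every first order
upper bound global: an element of the superdifferential, or the gradient of a test function touching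
from either side at an interior point, is a vector `q` with `V(x) ≤ V(k) + ⟨q, x - k⟩` wherever
`V(x) > -∞` (`IsSupergradient`). So all the claims reduce to two inequalities for such `q`.

Upper inequality (`Standing.rho_mul_value_le`). Follow a nearly optimal control up to time `t` and
bound `V(K(t))` by the supergradient inequality. Variation of constants turns `⟨q, K(t)⟩` into an
integral of `⟨q, e^{(t-s)B} N C(s)⟩`. Controls are not bounded, so `e^{(t-s)B}` cannot simply be
replaced by the identity; instead `e^{sB}x ≥ e^{-νs}x` on the orthant, and `q ≥ 0` because `V` is
monotone. The integrand is thus at most the Hamiltonian expression with `q` multiplied by a factor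
tending to 1, and homogeneity of the utility (`exists_scaled_bound`) shows that this costs nothing
in the limit after division by `t`.

Lower inequality (`Standing.le_rho_mul_value`). If a path with constant consumption `c` runs inside
the orthant and reaches `k` after time `t`, then following it and continuing nearly optimally bounds
`V` from below at its starting point, while the supergradient bounds it from above there. Dividing
by `t` gives the inequality for `c`. In the interior every `c` is allowed, hence equality with the
full Hamiltonian; at the boundary only the inward controls remain.

Finiteness. Pairing a path with `e^{-λt} b` bounds discounted consumption by `⟨b, k⟩`, and `ρ > λ(1
- γ)` lets this dominate discounted utility, so `V < +∞`. In the open orthant `V > -∞` follows from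
explicit controls if `γ ≤ 1`, and from homogeneity and monotonicity if `γ > 1`. -/

/-! ### The positive orthant and its order. -/

section Orthant

variable {n : ℕ} {x y k q : EuclideanSpace ℝ (Fin n)}

theorem closedOrthant_add (hx : x ∈ closedOrthant n) (hy : y ∈ closedOrthant n) :
    x + y ∈ closedOrthant n := fun i => add_nonneg (hx i) (hy i)

theorem closedOrthant_smul {a : ℝ} (ha : 0 ≤ a) (hx : x ∈ closedOrthant n) :
    a • x ∈ closedOrthant n := fun i => mul_nonneg ha (hx i)

theorem zero_mem_closedOrthant : (0 : EuclideanSpace ℝ (Fin n)) ∈ closedOrthant n :=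
  fun _ => le_rfl

theorem openOrthant_subset_closedOrthant : openOrthant n ⊆ closedOrthant n :=
  fun _ hx i => (hx i).le

theorem single_mem_closedOrthant (i : Fin n) :
    EuclideanSpace.single i (1 : ℝ) ∈ closedOrthant n := by
  intro j
  by_cases h : j = i <;> simp [h]

theorem convex_closedOrthant : Convex ℝ (closedOrthant n) := fun _ hx _ hy _ _ ha hb _ =>
  closedOrthant_add (closedOrthant_smul ha hx) (closedOrthant_smul hb hy)

theorem convex_openOrthant : Convex ℝ (openOrthant n) := by
  intro x hx y hy a b ha hb hab i
  have h1 := hx i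
  have h2 := hy i
  simp only [PiLp.add_apply, PiLp.smul_apply, smul_eq_mul]
  rcases ha.eq_or_lt with rfl | ha
  · have : b = 1 := by linarith
    subst this; simpa using h2
  · exact add_pos_of_pos_of_nonneg (mul_pos ha h1) (mul_nonneg hb h2.le)

theorem isClosed_closedOrthant : IsClosed (closedOrthant n) := by
  have : closedOrthant n = ⋂ i, {x : EuclideanSpace ℝ (Fin n) | 0 ≤ x i} := by
    ext x; simp [closedOrthant]
  rw [this]
  exact isClosed_iInter fun i => isClosed_le continuous_const (by fun_prop)

theorem isOpen_openOrthant : IsOpen (openOrthant n) := by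
  have : openOrthant n = ⋂ i, {x : EuclideanSpace ℝ (Fin n) | 0 < x i} := by
    ext x; simp [openOrthant]
  rw [this]
  exact isOpen_iInter_of_finite fun i => isOpen_lt continuous_const (by fun_prop)

theorem inner_eq_sum (x y : EuclideanSpace ℝ (Fin n)) : ⟪x, y⟫_ℝ = ∑ i, x i * y i := by
  simp [PiLp.inner_apply, mul_comm]

theorem inner_nonneg_of_mem_closedOrthant (hx : x ∈ closedOrthant n) (hy : y ∈ closedOrthant n) :
    0 ≤ ⟪x, y⟫_ℝ := by
  rw [inner_eq_sum]
  exact Finset.sum_nonneg fun i _ => mul_nonneg (hx i) (hy i)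

/-- A small enough multiple of any vector can be subtracted from a point of the open orthant
without leaving the closed orthant. -/
theorem exists_pos_smul_le (hk : k ∈ openOrthant n) (x : EuclideanSpace ℝ (Fin n)) :
    ∃ a : ℝ, 0 < a ∧ k - a • x ∈ closedOrthant n := by
  have h : ∀ᶠ a in 𝓝[>] (0 : ℝ), k - a • x ∈ openOrthant n := by
    have hc : Tendsto (fun a : ℝ => k - a • x) (𝓝 0) (𝓝 k) := by
      have : Continuous fun a : ℝ => k - a • x := by fun_prop
      simpa using this.tendsto 0
    exact (hc.eventually (isOpen_openOrthant.mem_nhds hk)).filter_mono nhdsWithin_le_nhds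
  obtain ⟨a, ha, ha0⟩ := (h.and self_mem_nhdsWithin).exists
  exact ⟨a, ha0, openOrthant_subset_closedOrthant ha⟩

end Orthant

/-! ### Exponentials of bounded operators. -/

section OperatorExponential

variable {F : Type*} [NormedAddCommGroup F] [NormedSpace ℝ F]

theorem exp_zero_smul_apply (B : F →L[ℝ] F) (x : F) : NormedSpace.exp ((0 : ℝ) • B) x = x := by
  simp [NormedSpace.exp_zero]

variable [CompleteSpace F]

theorem hasDerivAt_exp_smul_apply (B : F →L[ℝ] F) (x : F) (t : ℝ) :
    HasDerivAt (fun t : ℝ => NormedSpace.exp (t • B) x) (B (NormedSpace.exp (t • B) x)) t :=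
  (hasDerivAt_exp_smul_const' B t).clm_apply (hasDerivAt_const t x) |>.congr_deriv (by simp)

theorem exp_smul_exp_smul_apply (B : F →L[ℝ] F) (s t : ℝ) (x : F) :
    NormedSpace.exp (s • B) (NormedSpace.exp (t • B) x) = NormedSpace.exp ((s + t) • B) x := by
  let : NormedAlgebra ℚ (F →L[ℝ] F) := .restrictScalars ℚ ℝ _
  rw [add_smul, NormedSpace.exp_add_of_commute ((Commute.refl B).smul_left s |>.smul_right t)]
  rfl

theorem continuous_exp_smul (B : F →L[ℝ] F) : Continuous fun t : ℝ => NormedSpace.exp (t • B) :=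
  continuous_iff_continuousAt.2 fun t => (hasDerivAt_exp_smul_const' B t).continuousAt

theorem hasDerivAt_exp_smul (B : F →L[ℝ] F) (t : ℝ) :
    HasDerivAt (fun t : ℝ => NormedSpace.exp (t • B)) (B ∘L NormedSpace.exp (t • B)) t :=
  hasDerivAt_exp_smul_const' B t

/-- The exponential series of `t • B`, expanded around the scalar operator `-ν`. -/
theorem hasSum_exp_smul_apply (B : F →L[ℝ] F) (ν t : ℝ) (x : F) :
    HasSum (fun m : ℕ => (Real.exp (-(ν * t)) * (m.factorial : ℝ)⁻¹ * t ^ m) •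
      (fun y => B y + ν • y)^[m] x) (NormedSpace.exp (t • B) x) := by
  let : NormedAlgebra ℚ (F →L[ℝ] F) := .restrictScalars ℚ ℝ _
  have h1 : NormedSpace.exp (t • B) =
      Real.exp (-(ν * t)) • NormedSpace.exp (t • (B + ν • (1 : F →L[ℝ] F))) := by
    have hc : Commute (t • (B + ν • (1 : F →L[ℝ] F))) (algebraMap ℝ (F →L[ℝ] F) (-(ν * t))) :=
      (Algebra.commutes _ _).symm
    have h2 : t • B = t • (B + ν • (1 : F →L[ℝ] F)) + algebraMap ℝ (F →L[ℝ] F) (-(ν * t)) := by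
      rw [Algebra.algebraMap_eq_smul_one, smul_add, smul_smul, neg_smul, mul_comm ν]
      abel
    rw [h2, NormedSpace.exp_add_of_commute hc, ← NormedSpace.algebraMap_exp_comm,
      ← Real.exp_eq_exp_ℝ, ← Algebra.commutes, ← Algebra.smul_def]
  have hpow : ∀ m : ℕ, ((t • (B + ν • (1 : F →L[ℝ] F))) ^ m) x =
      t ^ m • (fun y => B y + ν • y)^[m] x := by
    intro m
    rw [smul_pow, smul_apply]
    congr 1
    induction m with
    | zero => simp
    | succ m ih => rw [pow_succ', Function.iterate_succ_apply', ← ih]; simp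
  have h := ((NormedSpace.exp_series_hasSum_exp' (𝕂 := ℝ)
    (t • (B + ν • (1 : F →L[ℝ] F)))).mapL (ContinuousLinearMap.apply ℝ F x)).const_smul
      (Real.exp (-(ν * t)))
  rw [h1, smul_apply]
  convert h using 2 with m
  rw [ContinuousLinearMap.apply_apply, smul_apply, hpow, smul_smul, smul_smul]
  rfl

end OperatorExponential

/-! ### Positive semigroups and their generators. -/

section PositiveExponential

variable {n : ℕ} {x : EuclideanSpace ℝ (Fin n)}
  {B : EuclideanSpace ℝ (Fin n) →L[ℝ] EuclideanSpace ℝ (Fin n)}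

/-- The `i`-th coordinate of `e^{tB}x` starts at 0 and stays nonnegative, so its right derivative at
0 is nonnegative. -/
theorem nonneg_apply_of_exp_nonneg
    (hB : ∀ t : ℝ, 0 ≤ t → ∀ x ∈ closedOrthant n, NormedSpace.exp (t • B) x ∈ closedOrthant n)
    (hx : x ∈ closedOrthant n) {i : Fin n} (hi : x i = 0) : 0 ≤ B x i := by
  have h1 : HasDerivAt (fun t : ℝ => NormedSpace.exp (t • B) x i) (B x i) 0 := by
    have := hasDerivAt_exp_smul_apply B x 0
    rw [exp_zero_smul_apply] at this
    exact (EuclideanSpace.proj (𝕜 := ℝ) i).hasFDerivAt.comp_hasDerivAt 0 this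
  have h2 := h1.hasDerivWithinAt (s := Ioi 0) 
  rw [hasDerivWithinAt_iff_tendsto_slope] at h2
  have : Ioi (0 : ℝ) \ {0} = Ioi 0 := by simp
  rw [this] at h2
  refine ge_of_tendsto h2 ?_
  filter_upwards [self_mem_nhdsWithin] with t ht
  rw [slope_def_field, exp_zero_smul_apply, hi]
  have := hB t (le_of_lt ht) x hx i
  exact div_nonneg (by simpa using this) (by simpa using (le_of_lt ht))

/-- The generator has nonnegative off-diagonal entries: apply the previous lemma to `x` with its
`i`-th coordinate removed. The diagonal entries are at least `-‖B‖`, which the shift compensates. -/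
theorem exists_shift_of_exp_nonneg
    (hB : ∀ t : ℝ, 0 ≤ t → ∀ x ∈ closedOrthant n, NormedSpace.exp (t • B) x ∈ closedOrthant n) :
    ∀ x ∈ closedOrthant n, B x + ‖B‖ • x ∈ closedOrthant n := by
  intro x hx i
  have hy : x - x i • EuclideanSpace.single i (1 : ℝ) ∈ closedOrthant n := by
    intro j
    by_cases h : j = i
    · subst h; simp
    · simpa [h] using hx j
  have h1 := nonneg_apply_of_exp_nonneg hB hy (i := i) (by simp)
  have h2 : -‖B‖ ≤ B (EuclideanSpace.single i (1 : ℝ)) i := by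
    have a1 := B.le_opNorm (EuclideanSpace.single i (1 : ℝ))
    have a2 := PiLp.norm_apply_le (B (EuclideanSpace.single i (1 : ℝ))) i
    have a3 := neg_abs_le (B (EuclideanSpace.single i (1 : ℝ)) i)
    simp at a1
    rw [Real.norm_eq_abs] at a2
    linarith
  have h3 := hx i
  simp only [map_sub, map_smul, PiLp.sub_apply, PiLp.smul_apply, smul_eq_mul] at h1
  simp only [PiLp.add_apply, PiLp.smul_apply, smul_eq_mul]
  nlinarith

/-- Every term of the exponential series expanded around `-ν` lies in the orthant; its term of order
zero is `e^{-νt}x`. This quantitative positivity is what later controls unbounded consumption. -/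
theorem exp_smul_apply_sub_mem_closedOrthant {ν : ℝ}
    (hν : ∀ x ∈ closedOrthant n, B x + ν • x ∈ closedOrthant n) {t : ℝ} (ht : 0 ≤ t)
    (hx : x ∈ closedOrthant n) :
    NormedSpace.exp (t • B) x - Real.exp (-(ν * t)) • x ∈ closedOrthant n := by
  intro i
  have hpow : ∀ m : ℕ, (fun y => B y + ν • y)^[m] x ∈ closedOrthant n := by
    intro m
    induction m with
    | zero => simpa using hx
    | succ m ih => rw [Function.iterate_succ_apply']; exact hν _ ih
  have h := (hasSum_exp_smul_apply B ν t x).mapL (EuclideanSpace.proj (𝕜 := ℝ) i)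
  have h3 := le_hasSum h 0 (fun j _ => by
    have h1 := hpow j i
    have h2 : 0 ≤ Real.exp (-(ν * t)) * (j.factorial : ℝ)⁻¹ * t ^ j := by positivity
    exact mul_nonneg h2 h1)
  simp only [Nat.factorial_zero, Nat.cast_one, inv_one, mul_one, pow_zero,
    Function.iterate_zero, id_eq] at h3
  exact sub_nonneg.2 h3

theorem exp_smul_apply_mem_closedOrthant {ν : ℝ}
    (hν : ∀ x ∈ closedOrthant n, B x + ν • x ∈ closedOrthant n) {t : ℝ} (ht : 0 ≤ t)
    (hx : x ∈ closedOrthant n) : NormedSpace.exp (t • B) x ∈ closedOrthant n := by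
  have := closedOrthant_add (exp_smul_apply_sub_mem_closedOrthant hν ht hx)
    (closedOrthant_smul (Real.exp_pos (-(ν * t))).le hx)
  simpa using this

end PositiveExponential

namespace GrowthModel

variable {n : ℕ} (M : GrowthModel n)

theorem drift_apply (x : EuclideanSpace ℝ (Fin n)) (i : Fin n) :
    M.drift x i = M.L x i + M.A i * x i := by
  simp [drift, Matrix.mulVec_diagonal]

/-- Adding `A` only increases the diagonal entries, so the shift found for `L` still works. -/
theorem exists_shift (hA : ∀ i, 0 < M.A i)
    (hL : ∀ t : ℝ, 0 ≤ t → ∀ x ∈ closedOrthant n,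
      NormedSpace.exp (t • M.L) x ∈ closedOrthant n) :
    ∃ ν : ℝ, 0 ≤ ν ∧ ∀ x ∈ closedOrthant n, M.drift x + ν • x ∈ closedOrthant n := by
  refine ⟨‖M.L‖, norm_nonneg _, fun x hx i => ?_⟩
  have h1 := exists_shift_of_exp_nonneg hL x hx i
  have h2 := mul_nonneg (hA i).le (hx i)
  simp only [PiLp.add_apply, drift_apply] at h1 ⊢
  linarith

end GrowthModel

/-! ### Forced linear equations and pairing with the adjoint equation. -/

section LinearODE

variable {F : Type*} [NormedAddCommGroup F] [NormedSpace ℝ F] [CompleteSpace F]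

/-- Variation of constants: solutions of `D' = B D + g` for a continuous forcing term `g`. -/
theorem exists_forced_solution (B : F →L[ℝ] F) {g : ℝ → F} (hg : Continuous g) (x : F) :
    ∃ D : ℝ → F, (∀ t, HasDerivAt D (B (D t) + g t) t) ∧ D 0 = x ∧
      ∀ t, D t = NormedSpace.exp (t • B) x +
        ∫ s in (0 : ℝ)..t, NormedSpace.exp ((t - s) • B) (g s) := by
  have hc : Continuous fun s : ℝ => NormedSpace.exp ((-s) • B) (g s) :=
    ((continuous_exp_smul B).comp continuous_neg).clm_apply hg
  refine ⟨fun t => NormedSpace.exp (t • B)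
    (x + ∫ s in (0 : ℝ)..t, NormedSpace.exp ((-s) • B) (g s)), fun t => ?_, ?_, fun t => ?_⟩
  · have h1 := (intervalIntegral.integral_hasDerivAt_right (hc.intervalIntegrable 0 t)
      (hc.stronglyMeasurableAtFilter _ _) hc.continuousAt).const_add x
    refine ((hasDerivAt_exp_smul B t).clm_apply h1).congr_deriv ?_
    rw [exp_smul_exp_smul_apply, add_neg_cancel, exp_zero_smul_apply]
    rfl
  · beta_reduce
    rw [intervalIntegral.integral_same, add_zero, exp_zero_smul_apply]
  · beta_reduce
    rw [map_add, ← ContinuousLinearMap.intervalIntegral_comp_comm _ (hc.intervalIntegrable 0 t)]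
    simp only [exp_smul_exp_smul_apply, sub_eq_add_neg]

end LinearODE

section Pairing

/-- The product rule for a `C¹` function and an indefinite integral. -/
theorem integral_deriv_mul_add_mul {u u' f : ℝ → ℝ} {a T : ℝ}
    (hu : ∀ t, HasDerivAt u (u' t) t) (hu' : Continuous u')
    (hf : IntervalIntegrable f volume 0 T) :
    ∫ t in (0 : ℝ)..T, (u' t * (a + ∫ s in (0 : ℝ)..t, f s) + u t * f t) =
      u T * (a + ∫ s in (0 : ℝ)..T, f s) - u 0 * a := by
  have hderiv : deriv u = u' := funext fun t => (hu t).deriv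
  have hu1 : ContDiff ℝ 1 u :=
    contDiff_one_iff_deriv.2 ⟨fun t => (hu t).differentiableAt, hderiv ▸ hu'⟩
  -- Since `f` is only integrable, integration by parts is used in its form for absolutely
  -- continuous functions.
  have hac : AbsolutelyContinuousOnInterval u 0 T :=
    hu1.contDiffOn.absolutelyContinuousOnInterval
  have hac2 : AbsolutelyContinuousOnInterval (fun t => a + ∫ s in (0 : ℝ)..t, f s) 0 T :=
    (contDiff_const (c := a)).contDiffOn.absolutelyContinuousOnInterval.add
      (hf.absolutelyContinuousOnInterval_intervalIntegral left_mem_uIcc)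
  have h := hac.integral_deriv_mul_eq_sub hac2
  simp only [intervalIntegral.integral_same, add_zero] at h
  rw [← h]
  apply intervalIntegral.integral_congr_ae
  filter_upwards [hf.ae_hasDerivAt_integral] with t ht hmem
  have := (ht (uIoc_subset_uIcc hmem) 0 left_mem_uIcc).const_add a
  rw [this.deriv, hderiv]

variable {n : ℕ}

theorem integral_inner_deriv_add_inner {K f w w' : ℝ → EuclideanSpace ℝ (Fin n)}
    {k : EuclideanSpace ℝ (Fin n)} {T : ℝ} (hT : 0 ≤ T)
    (hf : IntervalIntegrable f volume 0 T)
    (hK : ∀ t ∈ Icc 0 T, K t = k + ∫ s in (0 : ℝ)..t, f s)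
    (hw : ∀ t, HasDerivAt w (w' t) t) (hw' : Continuous w') :
    ∫ t in (0 : ℝ)..T, (⟪w' t, K t⟫_ℝ + ⟪w t, f t⟫_ℝ) = ⟪w T, K T⟫_ℝ - ⟪w 0, k⟫_ℝ := by
  have hproj : ∀ i t, t ∈ Icc 0 T → K t i = k i + ∫ s in (0 : ℝ)..t, f s i := by
    intro i t ht
    rw [hK t ht, PiLp.add_apply]
    congr 1
    have hft : IntervalIntegrable f volume 0 t := hf.mono_set (by
      rw [uIcc_of_le hT, uIcc_of_le ht.1]; exact Icc_subset_Icc_right ht.2)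
    exact ((EuclideanSpace.proj (𝕜 := ℝ) i).intervalIntegral_comp_comm hft).symm
  have hfi : ∀ i, IntervalIntegrable (fun t => f t i) volume 0 T := fun i =>
    ⟨(EuclideanSpace.proj (𝕜 := ℝ) i).integrable_comp hf.1,
      (EuclideanSpace.proj (𝕜 := ℝ) i).integrable_comp hf.2⟩
  have hwi : ∀ i t, HasDerivAt (fun t => w t i) (w' t i) t := fun i t =>
    (EuclideanSpace.proj (𝕜 := ℝ) i).hasFDerivAt.comp_hasDerivAt t (hw t)
  have hwi' : ∀ i, Continuous fun t => w' t i := fun i =>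
    (EuclideanSpace.proj (𝕜 := ℝ) i).continuous.comp hw'
  have key := fun i => integral_deriv_mul_add_mul (a := k i) (hwi i) (hwi' i) (hfi i)
  have hwc : ∀ i, Continuous fun t => w t i := fun i =>
    continuous_iff_continuousAt.2 fun t => (hwi i t).continuousAt
  have e1 : ∫ t in (0 : ℝ)..T, (⟪w' t, K t⟫_ℝ + ⟪w t, f t⟫_ℝ) =
      ∫ t in (0 : ℝ)..T, ∑ i, (w' t i * (k i + ∫ s in (0 : ℝ)..t, f s i) + w t i * f t i) := by
    apply intervalIntegral.integral_congr
    intro t ht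
    rw [uIcc_of_le hT] at ht
    simp only [inner_eq_sum, ← Finset.sum_add_distrib]
    exact Finset.sum_congr rfl fun i _ => by rw [hproj i t ht]
  rw [e1, intervalIntegral.integral_finsetSum, Finset.sum_congr rfl fun i _ => key i,
    inner_eq_sum, inner_eq_sum, ← Finset.sum_sub_distrib]
  · exact Finset.sum_congr rfl fun i _ => by rw [hproj i T ⟨hT, le_rfl⟩]
  · intro i _
    have hc : ContinuousOn (fun t => ∫ s in (0 : ℝ)..t, f s i) (uIcc 0 T) :=
      intervalIntegral.continuousOn_primitive_interval' (hfi i) left_mem_uIcc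
    exact (((hwi' i).continuousOn.mul (continuousOn_const.add hc)).intervalIntegrable).add
      ((hfi i).continuousOn_mul (hwc i).continuousOn)

end Pairing

theorem inner_exp_adjoint {F : Type*} [NormedAddCommGroup F] [InnerProductSpace ℝ F]
    [CompleteSpace F] (B : F →L[ℝ] F) (t : ℝ) (q x : F) :
    ⟪NormedSpace.exp (t • ContinuousLinearMap.adjoint B) q, x⟫_ℝ =
      ⟪q, NormedSpace.exp (t • B) x⟫_ℝ := by
  have : NormedSpace.exp (t • ContinuousLinearMap.adjoint B) =
      ContinuousLinearMap.adjoint (NormedSpace.exp (t • B)) := by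
    rw [← ContinuousLinearMap.star_eq_adjoint, ← ContinuousLinearMap.star_eq_adjoint]
    let : NormedAlgebra ℚ (F →L[ℝ] F) := .restrictScalars ℚ ℝ _
    rw [NormedSpace.star_exp, star_smul, star_trivial t]
  rw [this, ContinuousLinearMap.adjoint_inner_left]

theorem intervalIntegrable_of_locallyIntegrableOn {n : ℕ}
    {C : ℝ → EuclideanSpace ℝ (Fin n)} {S : Set ℝ} (hS : S.OrdConnected) (hC : LocallyIntegrableOn C S)
    {a b : ℝ} (ha : a ∈ S) (hb : b ∈ S) : IntervalIntegrable C volume a b :=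
  (hC.integrableOn_compact_subset (hS.uIcc_subset ha hb) isCompact_uIcc).intervalIntegrable

namespace GrowthModel

variable {n : ℕ} (M : GrowthModel n) {k : EuclideanSpace ℝ (Fin n)}
  {C K : ℝ → EuclideanSpace ℝ (Fin n)} {S : Set ℝ}

theorem intervalIntegrable_velocity (hS : S.OrdConnected) (hC : LocallyIntegrableOn C S)
    (hK : ContinuousOn K S) {a b : ℝ} (ha : a ∈ S) (hb : b ∈ S) :
    IntervalIntegrable (fun s => M.drift (K s) - M.N (C s)) volume a b := by
  have h1 : IntervalIntegrable (fun s => M.drift (K s)) volume a b :=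
    (M.drift.continuous.comp_continuousOn
      (hK.mono (hS.uIcc_subset ha hb))).intervalIntegrable
  have h2 := intervalIntegrable_of_locallyIntegrableOn hS hC ha hb
  exact h1.sub ⟨M.N.integrable_comp h2.1, M.N.integrable_comp h2.2⟩

theorem isCapitalPath_of_hasDerivAt (hC : Continuous C)
    (hK : ∀ t, HasDerivAt K (M.drift (K t) - M.N (C t)) t) (h0 : K 0 = k) :
    M.IsCapitalPath S k C K := by
  have hKc : Continuous K := continuous_iff_continuousAt.2 fun t => (hK t).continuousAt
  refine ⟨hKc.continuousOn, fun t _ => ?_⟩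
  have hc : Continuous fun s => M.drift (K s) - M.N (C s) := by fun_prop
  rw [intervalIntegral.integral_eq_sub_of_hasDerivAt (fun s _ => hK s)
    (hc.intervalIntegrable 0 t), h0]
  abel

/-- The adjoint equation eliminates the state from the pairing with a path. -/
theorem integral_inner_consumption (hC : LocallyIntegrableOn C (Ici 0))
    (hK : M.IsCapitalPath (Ici 0) k C K) {w : ℝ → EuclideanSpace ℝ (Fin n)}
    (hw : ∀ t, HasDerivAt w (-ContinuousLinearMap.adjoint M.drift (w t)) t)
    {T : ℝ} (hT : 0 ≤ T) :
    ∫ t in (0 : ℝ)..T, ⟪w t, M.N (C t)⟫_ℝ = ⟪w 0, k⟫_ℝ - ⟪w T, K T⟫_ℝ := by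
  have hwc : Continuous w := continuous_iff_continuousAt.2 fun t => (hw t).continuousAt
  have h := integral_inner_deriv_add_inner (w := w) hT
    (M.intervalIntegrable_velocity ordConnected_Ici hC hK.1 (mem_Ici.2 le_rfl) (mem_Ici.2 hT))
    (fun t ht => hK.2 t ht.1) hw (by fun_prop)
  rw [← neg_sub, ← h, ← intervalIntegral.integral_neg]
  apply intervalIntegral.integral_congr
  intro t _
  simp only [inner_neg_left, inner_sub_right, ContinuousLinearMap.adjoint_inner_left]
  ring

/-- Variation of constants tested against `q`: the adjoint solution `e^{(T-s)B*}q` equals `q` at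
time `T`, and moving the exponential across the inner product gives the formula. No differentiation
of `K` is needed. -/
theorem inner_capitalPath (hC : LocallyIntegrableOn C (Ici 0))
    (hK : M.IsCapitalPath (Ici 0) k C K) (q : EuclideanSpace ℝ (Fin n)) {T : ℝ} (hT : 0 ≤ T) :
    ⟪q, K T⟫_ℝ = ⟪q, NormedSpace.exp (T • M.drift) k⟫_ℝ -
      ∫ s in (0 : ℝ)..T, ⟪q, NormedSpace.exp ((T - s) • M.drift) (M.N (C s))⟫_ℝ := by
  have hw : ∀ t, HasDerivAt
      (fun s => NormedSpace.exp ((T - s) • ContinuousLinearMap.adjoint M.drift) q)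
      (-ContinuousLinearMap.adjoint M.drift
        (NormedSpace.exp ((T - t) • ContinuousLinearMap.adjoint M.drift) q)) t := by
    intro t
    have h1 : HasDerivAt (fun s : ℝ => T - s) (-1) t := by
      simpa using (hasDerivAt_id t).const_sub T
    have h2 := (hasDerivAt_exp_smul_apply (ContinuousLinearMap.adjoint M.drift) q
      (T - t)).scomp t h1
    refine h2.congr_deriv ?_
    rw [neg_smul, one_smul]
  have h := M.integral_inner_consumption hC hK hw hT
  simp only [inner_exp_adjoint, sub_self, sub_zero] at h
  rw [exp_zero_smul_apply] at h
  linarith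

/-- The eigenvector gives the adjoint solution `e^{-λt}b`; the terminal term of the pairing is
nonnegative and can be dropped. This is the a priori bound on consumption. -/
theorem integral_exp_inner_le {lam : ℝ} {b : EuclideanSpace ℝ (Fin n)} (hb : b ∈ closedOrthant n)
    (hbeig : ContinuousLinearMap.adjoint M.drift b = lam • b)
    (hC : LocallyIntegrableOn C (Ici 0)) (hK : M.IsCapitalPath (Ici 0) k C K)
    {T : ℝ} (hT : 0 ≤ T) (hKT : K T ∈ closedOrthant n) :
    ∫ t in (0 : ℝ)..T, Real.exp (-lam * t) * ⟪b, M.N (C t)⟫_ℝ ≤ ⟪b, k⟫_ℝ := by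
  have hw : ∀ t, HasDerivAt (fun s => Real.exp (-lam * s) • b)
      (-ContinuousLinearMap.adjoint M.drift (Real.exp (-lam * t) • b)) t := by
    intro t
    have h1 : HasDerivAt (fun s : ℝ => -lam * s) (-lam) t := by
      simpa using (hasDerivAt_id t).const_mul (-lam)
    refine (h1.exp.smul_const b).congr_deriv ?_
    rw [map_smul, hbeig, smul_smul, ← neg_smul]
    congr 1; ring
  have h := M.integral_inner_consumption hC hK hw hT
  simp only [inner_smul_left, conj_trivial, mul_zero, Real.exp_zero, one_mul] at h
  rw [h]
  have := mul_nonneg (Real.exp_pos (-lam * T)).le (inner_nonneg_of_mem_closedOrthant hb hKT)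
  linarith

end GrowthModel

theorem locallyIntegrableOn_Ici_of_intervalIntegrable {F : Type*} [NormedAddCommGroup F]
    {f : ℝ → F} (h : ∀ T, 0 ≤ T → IntervalIntegrable f volume 0 T) :
    LocallyIntegrableOn f (Ici 0) := by
  rw [locallyIntegrableOn_iff isClosed_Ici.isLocallyClosed]
  intro s hs hsc
  obtain ⟨T, hT⟩ := hsc.bddAbove
  have h1 := (intervalIntegrable_iff_integrableOn_Icc_of_le (le_max_right T 0)).1
    (h (max T 0) (le_max_right _ _))
  exact h1.mono_set fun t ht => ⟨hs ht, (hT ht).trans (le_max_left _ _)⟩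

/-! ### Operations on admissible controls: superposition, time shift, concatenation. -/

namespace GrowthModel

variable {n : ℕ} (M : GrowthModel n) {k x y : EuclideanSpace ℝ (Fin n)}
  {C K C₁ C₂ K₁ K₂ : ℝ → EuclideanSpace ℝ (Fin n)} {S : Set ℝ}

variable {M}

theorem IsCapitalPath.add_smul (hS : S.OrdConnected) (h0 : (0 : ℝ) ∈ S)
    (hC₁ : LocallyIntegrableOn C₁ S) (hC₂ : LocallyIntegrableOn C₂ S)
    (h₁ : M.IsCapitalPath S x C₁ K₁) (h₂ : M.IsCapitalPath S y C₂ K₂) (a b : ℝ) :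
    M.IsCapitalPath S (a • x + b • y) (fun t => a • C₁ t + b • C₂ t)
      (fun t => a • K₁ t + b • K₂ t) := by
  refine ⟨(h₁.1.const_smul a).add (h₂.1.const_smul b), fun t ht => ?_⟩
  have i1 := M.intervalIntegrable_velocity hS hC₁ h₁.1 h0 ht
  have i2 := M.intervalIntegrable_velocity hS hC₂ h₂.1 h0 ht
  beta_reduce
  rw [h₁.2 t ht, h₂.2 t ht, smul_add, smul_add, add_add_add_comm,
    ← intervalIntegral.integral_smul, ← intervalIntegral.integral_smul,
    ← intervalIntegral.integral_add (by exact i1.smul a) (by exact i2.smul b)]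
  congr 1
  apply intervalIntegral.integral_congr
  intro s _
  simp only [map_add, map_smul, smul_sub]
  abel

theorem add_smul_mem_admissible (hx : C₁ ∈ M.admissible x) (hy : C₂ ∈ M.admissible y) {a b : ℝ}
    (ha : 0 ≤ a) (hb : 0 ≤ b) :
    (fun t => a • C₁ t + b • C₂ t) ∈ M.admissible (a • x + b • y) := by
  obtain ⟨i1, p1, K₁, hK₁, q1⟩ := hx
  obtain ⟨i2, p2, K₂, hK₂, q2⟩ := hy
  refine ⟨(i1.smul a).add (i2.smul b), fun t ht =>
    closedOrthant_add (closedOrthant_smul ha (p1 t ht)) (closedOrthant_smul hb (p2 t ht)), _,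
    hK₁.add_smul ordConnected_Ici (mem_Ici.2 le_rfl) i1 i2 hK₂ a b, fun t ht =>
    closedOrthant_add (closedOrthant_smul ha (q1 t ht)) (closedOrthant_smul hb (q2 t ht))⟩

theorem zero_mem_admissible {ν : ℝ}
    (hν : ∀ x ∈ closedOrthant n, M.drift x + ν • x ∈ closedOrthant n)
    (hk : k ∈ closedOrthant n) : (fun _ => 0) ∈ M.admissible k := by
  refine ⟨(continuous_const.locallyIntegrable).locallyIntegrableOn _,
    fun _ _ => zero_mem_closedOrthant, fun t => NormedSpace.exp (t • M.drift) k,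
    M.isCapitalPath_of_hasDerivAt continuous_const (fun t => ?_) (exp_zero_smul_apply _ _),
    fun t ht => exp_smul_apply_mem_closedOrthant hν ht hk⟩
  simpa using hasDerivAt_exp_smul_apply M.drift k t

/-- Superpose the uncontrolled path issued from `y - x`, which stays in the orthant because the
semigroup is positive. -/
theorem admissible_mono {ν : ℝ}
    (hν : ∀ x ∈ closedOrthant n, M.drift x + ν • x ∈ closedOrthant n)
    (hk : y - x ∈ closedOrthant n) (hC : C ∈ M.admissible x) : C ∈ M.admissible y := by
  have h := add_smul_mem_admissible hC (zero_mem_admissible hν hk) zero_le_one zero_le_one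
  simpa using h

theorem smul_mem_admissible (hC : C ∈ M.admissible x) {a : ℝ} (ha : 0 ≤ a) :
    (fun t => a • C t) ∈ M.admissible (a • x) := by
  have h := add_smul_mem_admissible hC hC ha le_rfl
  simpa using h

theorem intervalIntegrable_of_admissible (hC : C ∈ M.admissible k) {a b : ℝ} (ha : 0 ≤ a)
    (hb : 0 ≤ b) : IntervalIntegrable C volume a b :=
  intervalIntegrable_of_locallyIntegrableOn ordConnected_Ici hC.1 ha hb

theorem shift_mem_admissible (hC : C ∈ M.admissible k) (hK : M.IsCapitalPath (Ici 0) k C K)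
    (hK0 : ∀ t ∈ Ici (0 : ℝ), K t ∈ closedOrthant n) {t : ℝ} (ht : 0 ≤ t) :
    (fun s => C (s + t)) ∈ M.admissible (K t) := by
  refine ⟨locallyIntegrableOn_Ici_of_intervalIntegrable fun T hT => ?_,
    fun s hs => hC.2.1 _ (add_nonneg hs ht), fun s => K (s + t), ⟨?_, fun s hs => ?_⟩,
    fun s hs => hK0 _ (add_nonneg hs ht)⟩
  · have h := (intervalIntegrable_of_admissible hC ht (add_nonneg hT ht)).comp_add_right t
    simpa using h
  · exact hK.1.comp (by fun_prop) fun s hs => add_nonneg hs ht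
  · have i1 := M.intervalIntegrable_velocity ordConnected_Ici hC.1 hK.1 (mem_Ici.2 le_rfl)
      (mem_Ici.2 ht)
    have i2 := M.intervalIntegrable_velocity ordConnected_Ici hC.1 hK.1 (mem_Ici.2 ht)
      (mem_Ici.2 (add_nonneg hs ht))
    beta_reduce
    rw [hK.2 _ (add_nonneg hs ht), hK.2 t ht, add_assoc,
      intervalIntegral.integral_comp_add_right (fun s => M.drift (K s) - M.N (C s)) t, zero_add,
      intervalIntegral.integral_add_adjacent_intervals i1 i2]

/-- Following the constant control `c` along a path that reaches `k` at time `t`, and an admissible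
control for `k` afterwards. -/
theorem concat_mem_admissible {c : EuclideanSpace ℝ (Fin n)} {t : ℝ} (ht : 0 ≤ t)
    (hc : c ∈ closedOrthant n) (hK₁ : M.IsCapitalPath (Icc (-t) 0) k (fun _ => c) K₁)
    (hpos : ∀ s ∈ Icc (-t) 0, K₁ s ∈ closedOrthant n) (hC : C ∈ M.admissible k) :
    (fun s => if s ≤ t then c else C (s - t)) ∈ M.admissible (K₁ (-t)) := by
  obtain ⟨hCi, hCp, K, hK, hKp⟩ := hC
  have hK0 : K 0 = k := by simpa using hK.2 0 (mem_Ici.2 le_rfl)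
  have hK₁0 : K₁ 0 = k := by simpa using hK₁.2 0 ⟨by linarith, le_rfl⟩
  -- Gluing is done at time 0, on `[-t, ∞)`, where both paths take the value `k`; the result is
  -- shifted to `[0, ∞)` at the end.
  set C₀ : ℝ → EuclideanSpace ℝ (Fin n) := fun s => if s ≤ 0 then c else C s with hC₀
  set K₀ : ℝ → EuclideanSpace ℝ (Fin n) := fun s => if s ≤ 0 then K₁ s else K s with hK₀
  have int0 : ∀ T, 0 ≤ T → IntervalIntegrable C₀ volume 0 T := fun T hT => by
    refine (intervalIntegrable_of_locallyIntegrableOn ordConnected_Ici hCi (mem_Ici.2 le_rfl)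
      (mem_Ici.2 hT)).congr fun s hs => ?_
    rw [uIoc_of_le hT] at hs
    simp [hC₀, not_le.2 hs.1]
  have int1 : ∀ T, T ≤ 0 → IntervalIntegrable C₀ volume T 0 := fun T hT => by
    refine (intervalIntegrable_const (c := c)).congr fun s hs => ?_
    rw [uIoc_of_le hT] at hs
    simp [hC₀, hs.2]
  have hcont : ContinuousOn K₀ (Ici (-t)) := by
    have h : ContinuousOn K₀ (Icc (-t) 0 ∪ Ici 0) := by
      refine ContinuousOn.union_of_isClosed ?_ ?_ isClosed_Icc isClosed_Ici
      · exact hK₁.1.congr fun s hs => by simp [hK₀, hs.2]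
      · refine hK.1.congr fun s hs => ?_
        rcases (mem_Ici.1 hs).eq_or_lt with rfl | h
        · simp [hK₀, hK0, hK₁0]
        · simp [hK₀, not_le.2 h]
    rwa [Icc_union_Ici_eq_Ici (by linarith)] at h
  have hC₀loc : LocallyIntegrableOn C₀ (Ici (-t)) := by
    rw [locallyIntegrableOn_iff isClosed_Ici.isLocallyClosed]
    intro s hs hsc
    obtain ⟨T, hT⟩ := hsc.bddAbove
    have h1 := (int1 (-t) (by linarith)).trans (int0 (max T 0) (le_max_right _ _))
    rw [intervalIntegrable_iff_integrableOn_Icc_of_le (by linarith [le_max_right T 0])] at h1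
    exact h1.mono_set fun t ht => ⟨hs ht, (hT ht).trans (le_max_left _ _)⟩
  have hpath : ∀ s ∈ Ici (-t), K₀ s = k + ∫ r in (0 : ℝ)..s, (M.drift (K₀ r) - M.N (C₀ r)) := by
    intro s hs
    rcases le_or_gt s 0 with h | h
    · have : K₀ s = K₁ s := by simp [hK₀, h]
      rw [this, hK₁.2 s ⟨hs, h⟩]
      congr 1
      refine intervalIntegral.integral_congr_ae (Eventually.of_forall fun r hr => ?_)
      rw [uIoc_of_ge h] at hr
      simp [hK₀, hC₀, hr.2]
    · have : K₀ s = K s := by simp [hK₀, not_le.2 h]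
      rw [this, hK.2 s h.le]
      congr 1
      refine intervalIntegral.integral_congr_ae (Eventually.of_forall fun r hr => ?_)
      rw [uIoc_of_le h.le] at hr
      simp [hK₀, hC₀, not_le.2 hr.1]
  have hmem0 : (0 : ℝ) ∈ Ici (-t) := by simpa using ht
  have hmemt : -t ∈ Ici (-t) := mem_Ici.2 le_rfl
  have eC : (fun s => if s ≤ t then c else C (s - t)) = fun s => C₀ (s + -t) := by
    funext s
    simp [hC₀, sub_eq_add_neg]
  have eK : K₁ (-t) = K₀ (-t) := by simp [hK₀, ht]
  rw [eC, eK]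
  refine ⟨locallyIntegrableOn_Ici_of_intervalIntegrable fun T hT => ?_, fun s hs => ?_,
    fun s => K₀ (s + -t), ⟨?_, fun s hs => ?_⟩, fun s hs => ?_⟩
  · have h := (intervalIntegrable_of_locallyIntegrableOn ordConnected_Ici hC₀loc hmemt
      (b := T + -t) (by simpa using hT)).comp_add_right (-t)
    simpa using h
  · by_cases h : s + -t ≤ 0
    · simpa [hC₀, h] using hc
    · simpa only [hC₀, h, if_false] using hCp _ (mem_Ici.2 (not_le.1 h).le)
  · exact hcont.comp (by fun_prop) fun s hs => by simpa using hs
  · have hs' : s + -t ∈ Ici (-t) := by simpa using hs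
    have i1 := M.intervalIntegrable_velocity ordConnected_Ici hC₀loc hcont hmem0 hmemt
    have i2 := M.intervalIntegrable_velocity ordConnected_Ici hC₀loc hcont hmemt hs'
    beta_reduce
    rw [hpath _ hs', hpath _ hmemt, add_assoc,
      intervalIntegral.integral_comp_add_right (fun s => M.drift (K₀ s) - M.N (C₀ s)) (-t),
      zero_add, intervalIntegral.integral_add_adjacent_intervals i1 i2]
  · by_cases h : s + -t ≤ 0
    · simpa only [hK₀, h, if_true] using hpos _ ⟨by simpa using hs, h⟩
    · simpa only [hK₀, h, if_false] using hKp _ (mem_Ici.2 (not_le.1 h).le)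

end GrowthModel

/-! ### Growth and concavity of the utility. -/

/-- The real-valued utility, which agrees with `utility γ` wherever the latter is finite. -/
noncomputable def realUtility (γ x : ℝ) : ℝ :=
  if γ = 1 then Real.log x else x ^ (1 - γ) / (1 - γ)

theorem utility_eq_coe {γ x : ℝ} (h : 1 ≤ γ → x ≠ 0) :
    utility γ x = (realUtility γ x : EReal) := by
  unfold utility realUtility
  rw [if_neg fun hx => h hx.1 hx.2]
  split_ifs <;> rfl

theorem utility_zero_eq_bot {γ : ℝ} (h : 1 ≤ γ) : utility γ 0 = ⊥ := by
  simp [utility, h]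

theorem measurable_utility (γ : ℝ) : Measurable (utility γ) := by
  unfold utility
  refine Measurable.ite ?_ measurable_const ?_
  · exact (MeasurableSet.const _).inter (measurableSet_singleton 0)
  · by_cases h : γ = 1
    · simpa [h] using Real.measurable_log.coe_real_ereal
    · simp only [h, if_false]
      exact ((measurable_id.pow_const _).div_const _).coe_real_ereal

/-- The discounted utility is dominated by an integrable function of time plus a multiple of the
consumption discounted at the rate `lam`. -/
theorem exists_discounted_realUtility_le {γ ρ lam : ℝ} (hγ : 0 < γ) (hρ : 0 < ρ) (hlam : 0 < lam)
    (h : lam * (1 - γ) < ρ) :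
    ∃ a δ D : ℝ, 0 ≤ a ∧ 0 < δ ∧ 0 ≤ D ∧ ∀ t x : ℝ, 0 ≤ t → 0 ≤ x → (1 ≤ γ → x ≠ 0) →
      Real.exp (-ρ * t) * realUtility γ x ≤
        a * Real.exp (-δ * t) + D * (Real.exp (-lam * t) * x) := by
  rcases lt_trichotomy γ 1 with hγ1 | rfl | hγ1
  · refine ⟨1 / (1 - γ), ρ - lam * (1 - γ), 1 / (1 - γ), ?_, by linarith, ?_, ?_⟩
    · exact one_div_nonneg.2 (by linarith)
    · exact one_div_nonneg.2 (by linarith)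
    intro t x ht hx _
    have hpos : 0 < 1 - γ := by linarith
    -- In terms of `z`, consumption discounted at the rate `lam`, the power `x^{1-γ}` leaves the
    -- discount rate `ρ - lam (1 - γ) > 0`, and `z^{1-γ} ≤ 1 + z`.
    set z := Real.exp (-lam * t) * x with hz
    have hz0 : 0 ≤ z := by positivity
    have h1 : Real.exp (-ρ * t) * x ^ (1 - γ) =
        Real.exp (-(ρ - lam * (1 - γ)) * t) * z ^ (1 - γ) := by
      rw [hz, Real.mul_rpow (Real.exp_pos _).le hx, ← Real.exp_mul, ← mul_assoc, ← Real.exp_add]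
      congr 2; ring
    have h2 : z ^ (1 - γ) ≤ 1 + z := by
      rcases le_total z 1 with h | h
      · have := Real.rpow_le_one hz0 h hpos.le
        linarith
      · have := Real.rpow_le_rpow_of_exponent_le h (show 1 - γ ≤ 1 by linarith)
        rw [Real.rpow_one] at this
        linarith
    have h3 : Real.exp (-(ρ - lam * (1 - γ)) * t) ≤ 1 := by
      apply Real.exp_le_one_iff.2
      have : 0 ≤ (ρ - lam * (1 - γ)) * t := mul_nonneg (by linarith) ht
      linarith
    have h4 : Real.exp (-ρ * t) * x ^ (1 - γ) ≤
        Real.exp (-(ρ - lam * (1 - γ)) * t) + z := by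
      rw [h1]
      nlinarith [Real.exp_pos (-(ρ - lam * (1 - γ)) * t)]
    rw [realUtility, if_neg hγ1.ne, ← mul_add, mul_div_assoc', div_eq_inv_mul, one_div]
    exact mul_le_mul_of_nonneg_left h4 (by positivity)
  -- Here `log x = log z + lam t` with `log z ≤ z`; half of the discount rate is spent on absorbing
  -- the factor `t`.
  · refine ⟨lam * (2 / ρ), ρ / 2, 1, by positivity, by positivity, zero_le_one, ?_⟩
    intro t x ht hx hx0
    have hxp : 0 < x := lt_of_le_of_ne hx (hx0 le_rfl).symm
    rw [realUtility, if_pos rfl]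
    have h1 : Real.log x ≤ Real.exp (-lam * t) * x + lam * t := by
      have h := Real.log_le_sub_one_of_pos (mul_pos (Real.exp_pos (-lam * t)) hxp)
      rw [Real.log_mul (Real.exp_pos _).ne' hxp.ne', Real.log_exp] at h
      linarith
    have h2 : Real.exp (-ρ * t) ≤ 1 := Real.exp_le_one_iff.2 (by nlinarith)
    have h3 : t * Real.exp (-ρ * t) ≤ 2 / ρ * Real.exp (-(ρ / 2) * t) := by
      have e1 : Real.exp (-ρ * t) = Real.exp (-(ρ / 2) * t) * Real.exp (-(ρ / 2) * t) := by
        rw [← Real.exp_add]; congr 1; ring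
      have e2 : t * Real.exp (-(ρ / 2) * t) ≤ 2 / ρ := by
        have h := Real.add_one_le_exp (ρ / 2 * t)
        have e3 : Real.exp (ρ / 2 * t) * Real.exp (-(ρ / 2) * t) = 1 := by
          rw [← Real.exp_add]; simp
        have e4 : ρ / 2 * t * Real.exp (-(ρ / 2) * t) ≤ 1 := by
          rw [← e3]
          exact mul_le_mul_of_nonneg_right (by linarith) (Real.exp_pos _).le
        rw [le_div_iff₀ hρ]
        linarith
      rw [e1, ← mul_assoc]
      exact mul_le_mul_of_nonneg_right e2 (Real.exp_pos _).le
    have h4 : 0 ≤ Real.exp (-lam * t) * x := by positivity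
    calc Real.exp (-ρ * t) * Real.log x
        ≤ Real.exp (-ρ * t) * (Real.exp (-lam * t) * x + lam * t) :=
          mul_le_mul_of_nonneg_left h1 (Real.exp_pos _).le
      _ = lam * (t * Real.exp (-ρ * t)) + Real.exp (-ρ * t) * (Real.exp (-lam * t) * x) := by ring
      _ ≤ lam * (2 / ρ * Real.exp (-(ρ / 2) * t)) + 1 * (Real.exp (-lam * t) * x) :=
          add_le_add (mul_le_mul_of_nonneg_left h3 hlam.le) (mul_le_mul_of_nonneg_right h2 h4)
      _ = _ := by ring
  -- For `γ > 1` the utility is nonpositive, so zero is an upper bound.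
  · refine ⟨0, 1, 0, le_rfl, one_pos, le_rfl, fun t x _ hx _ => ?_⟩
    rw [realUtility, if_neg hγ1.ne', zero_mul, zero_mul, add_zero]
    exact mul_nonpos_of_nonneg_of_nonpos (Real.exp_pos _).le
      (div_nonpos_of_nonneg_of_nonpos (Real.rpow_nonneg hx _) (by linarith))

theorem concaveOn_realUtility_Ioi {γ : ℝ} (hγ : 0 < γ) :
    ConcaveOn ℝ (Ioi 0) (realUtility γ) := by
  rcases lt_trichotomy γ 1 with hγ1 | rfl | hγ1
  · have h := ((Real.concaveOn_rpow (p := 1 - γ) (by linarith) (by linarith)).subset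
      Ioi_subset_Ici_self (convex_Ioi 0)).smul (c := (1 - γ)⁻¹) (inv_nonneg.2 (by linarith))
    refine h.congr fun x _ => ?_
    simp only [realUtility, if_neg hγ1.ne, smul_eq_mul]
    ring
  · refine strictConcaveOn_log_Ioi.concaveOn.congr fun x _ => ?_
    simp [realUtility]
  · have h1 : ConvexOn ℝ (Ioi 0) fun x : ℝ => (1 - γ) * Real.log x := by
      have := (strictConcaveOn_log_Ioi.concaveOn.smul (c := γ - 1) (by linarith)).neg
      refine this.congr fun x _ => ?_
      simp only [Pi.neg_apply, smul_eq_mul]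
      ring
    -- The power `x^{1-γ}` is the convex increasing exponential of a convex function, hence convex;
    -- division by `1 - γ < 0` makes it concave.
    have h2 : ConvexOn ℝ (Ioi 0) fun x : ℝ => Real.exp ((1 - γ) * Real.log x) :=
      (convexOn_exp.subset (subset_univ _) ((isPreconnected_Ioi.image _ (fun x hx =>
        ((continuousAt_const.mul (Real.continuousAt_log (ne_of_gt hx))).continuousWithinAt))
          ).ordConnected.convex)).comp h1 (Real.exp_monotone.monotoneOn _)
    have h3 := (h2.smul (c := (γ - 1)⁻¹) (inv_nonneg.2 (by linarith))).neg
    refine h3.congr fun x hx => ?_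
    simp only [realUtility, if_neg hγ1.ne', Pi.neg_apply, smul_eq_mul]
    rw [Real.rpow_def_of_pos hx, mul_comm (Real.log x), div_eq_inv_mul, ← neg_mul, ← inv_neg,
      neg_sub]

/-- Concavity inequality for the utility at points where it is finite. -/
theorem realUtility_concave {γ x y a b : ℝ} (hγ : 0 < γ) (hx : 0 ≤ x) (hy : 0 ≤ y)
    (hx' : 1 ≤ γ → x ≠ 0) (hy' : 1 ≤ γ → y ≠ 0) (ha : 0 ≤ a) (hb : 0 ≤ b) (hab : a + b = 1) :
    a * realUtility γ x + b * realUtility γ y ≤ realUtility γ (a * x + b * y) := by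
  rcases lt_or_ge γ 1 with hγ1 | hγ1
  · have h := (Real.concaveOn_rpow (p := 1 - γ) (by linarith) (by linarith)).2
      (mem_Ici.2 hx) (mem_Ici.2 hy) ha hb hab
    simp only [smul_eq_mul] at h
    simp only [realUtility, if_neg hγ1.ne]
    rw [mul_div_assoc', mul_div_assoc', ← add_div]
    exact div_le_div_of_nonneg_right h (by linarith)
  · exact (concaveOn_realUtility_Ioi hγ).2 (lt_of_le_of_ne hx (hx' hγ1).symm)
      (lt_of_le_of_ne hy (hy' hγ1).symm) ha hb hab

theorem EReal.coe_finsetSum {ι : Type*} (s : Finset ι) (f : ι → ℝ) :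
    ((∑ i ∈ s, f i : ℝ) : EReal) = ∑ i ∈ s, (f i : EReal) := by
  classical
  induction s using Finset.induction_on with
  | empty => simp
  | insert a s ha ih => rw [Finset.sum_insert ha, Finset.sum_insert ha, EReal.coe_add, ih]

namespace GrowthModel

variable {n : ℕ} (M : GrowthModel n) {c : EuclideanSpace ℝ (Fin n)}

/-- The real-valued aggregate utility. -/
noncomputable def realAggregateUtility (c : EuclideanSpace ℝ (Fin n)) : ℝ :=
  ∑ i, M.p i * realUtility M.γ (c i)

/-- The consumption vectors of finite utility. -/
def FiniteUtility (c : EuclideanSpace ℝ (Fin n)) : Prop := 1 ≤ M.γ → ∀ i, c i ≠ 0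

variable {M}

theorem aggregateUtility_eq_coe (h : M.FiniteUtility c) :
    M.aggregateUtility c = (M.realAggregateUtility c : EReal) := by
  rw [aggregateUtility, realAggregateUtility, EReal.coe_finsetSum]
  refine Finset.sum_congr rfl fun i _ => ?_
  rw [utility_eq_coe fun hγ => h hγ i, EReal.coe_mul]

theorem aggregateUtility_eq_bot (hp : ∀ i, 0 < M.p i) (h : ¬ M.FiniteUtility c) :
    M.aggregateUtility c = ⊥ := by
  simp only [FiniteUtility, not_forall, not_not] at h
  obtain ⟨hγ, i, hi⟩ := h
  rw [aggregateUtility, ← Finset.add_sum_erase _ _ (Finset.mem_univ i), hi,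
    utility_zero_eq_bot hγ, EReal.coe_mul_bot_of_pos (hp i), EReal.bot_add]

theorem measurable_aggregateUtility : Measurable M.aggregateUtility := by
  unfold aggregateUtility
  refine Finset.measurable_sum _ fun i _ => Measurable.const_mul ?_ _
  exact (measurable_utility M.γ).comp (by fun_prop)

theorem realAggregateUtility_concave (hp : ∀ i, 0 < M.p i) (hγ : 0 < M.γ)
    {x y : EuclideanSpace ℝ (Fin n)} (hx : x ∈ closedOrthant n) (hy : y ∈ closedOrthant n)
    (hx' : M.FiniteUtility x) (hy' : M.FiniteUtility y) {a b : ℝ} (ha : 0 ≤ a) (hb : 0 ≤ b)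
    (hab : a + b = 1) :
    a * M.realAggregateUtility x + b * M.realAggregateUtility y ≤
      M.realAggregateUtility (a • x + b • y) := by
  simp only [realAggregateUtility, Finset.mul_sum, ← Finset.sum_add_distrib]
  refine Finset.sum_le_sum fun i _ => ?_
  have h := mul_le_mul_of_nonneg_left (realUtility_concave hγ (hx i) (hy i) (fun h => hx' h i)
    (fun h => hy' h i) ha hb hab) (hp i).le
  simp only [PiLp.add_apply, PiLp.smul_apply, smul_eq_mul]
  linarith

theorem finiteUtility_convex {x y : EuclideanSpace ℝ (Fin n)} (hx : x ∈ closedOrthant n)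
    (hy : y ∈ closedOrthant n) (hx' : M.FiniteUtility x) (hy' : M.FiniteUtility y) {a b : ℝ}
    (ha : 0 ≤ a) (hb : 0 ≤ b) (hab : a + b = 1) : M.FiniteUtility (a • x + b • y) := by
  intro hγ i
  have h1 : 0 < x i := lt_of_le_of_ne (hx i) (hx' hγ i).symm
  have h2 : 0 < y i := lt_of_le_of_ne (hy i) (hy' hγ i).symm
  exact ((convex_Ioi (0 : ℝ)) h1 h2 ha hb hab).ne'

theorem inner_map_eq_sum (b : EuclideanSpace ℝ (Fin n))
    (c : EuclideanSpace ℝ (Fin n)) :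
    ⟪b, M.N c⟫_ℝ = ∑ i, c i * ⟪b, M.N (EuclideanSpace.single i 1)⟫_ℝ := by
  have h : c = ∑ i, c i • EuclideanSpace.single i (1 : ℝ) := by
    ext j
    simp [Finset.sum_apply, Pi.single_apply]
  conv_lhs => rw [h]
  simp only [map_sum, map_smul, inner_sum, inner_smul_right]

theorem inner_map_single_pos (hN : ∀ x ∈ closedOrthant n, M.N x ∈ closedOrthant n)
    (hNe : ∀ i, M.N (EuclideanSpace.single i 1) ≠ 0) {b : EuclideanSpace ℝ (Fin n)}
    (hb : b ∈ openOrthant n) (i : Fin n) :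
    0 < ⟪b, M.N (EuclideanSpace.single i 1)⟫_ℝ := by
  have h0 := hN _ (single_mem_closedOrthant i)
  rw [inner_eq_sum]
  obtain ⟨j, hj⟩ : ∃ j, M.N (EuclideanSpace.single i 1) j ≠ 0 := by
    by_contra! hcon
    exact hNe i (by ext j; simpa using hcon j)
  exact Finset.sum_pos' (fun j _ => mul_nonneg (hb j).le (h0 j))
    ⟨j, Finset.mem_univ j, mul_pos (hb j) (lt_of_le_of_ne (h0 j) hj.symm)⟩

/-- Sum the scalar bound over the coordinates. As `⟨b, Nc⟩` is a combination of the `cᵢ` with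
positive coefficients `mᵢ`, a multiple of it dominates `∑ pᵢ cᵢ`; the sum of the ratios `pⱼ / mⱼ`
serves as the constant. -/
theorem exists_discounted_realAggregateUtility_le (hp : ∀ i, 0 < M.p i) (hρ : 0 < M.ρ)
    (hγ : 0 < M.γ) (hN : ∀ x ∈ closedOrthant n, M.N x ∈ closedOrthant n)
    (hNe : ∀ i, M.N (EuclideanSpace.single i 1) ≠ 0) {lam : ℝ} (hlam : 0 < lam)
    {b : EuclideanSpace ℝ (Fin n)} (hb : b ∈ openOrthant n) (hρlam : lam * (1 - M.γ) < M.ρ) :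
    ∃ a δ D : ℝ, 0 < δ ∧ 0 ≤ D ∧ ∀ (t : ℝ) (c : EuclideanSpace ℝ (Fin n)), 0 ≤ t →
      c ∈ closedOrthant n → M.FiniteUtility c →
      Real.exp (-M.ρ * t) * M.realAggregateUtility c ≤
        a * Real.exp (-δ * t) + D * (Real.exp (-lam * t) * ⟪b, M.N c⟫_ℝ) := by
  obtain ⟨a, δ, D, -, hδ, hD, h⟩ := exists_discounted_realUtility_le hγ hρ hlam hρlam
  have hm := inner_map_single_pos hN hNe hb
  set m : Fin n → ℝ := fun i => ⟪b, M.N (EuclideanSpace.single i 1)⟫_ℝ with hmdef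
  obtain ⟨D', hD', hD'p⟩ : ∃ D' : ℝ, 0 ≤ D' ∧ ∀ i, M.p i ≤ D' * m i := by
    have hterm : ∀ j, 0 ≤ M.p j / m j := fun j => (div_pos (hp j) (hm j)).le
    refine ⟨∑ j, M.p j / m j, Finset.sum_nonneg fun j _ => hterm j, fun i => ?_⟩
    rw [← div_le_iff₀ (hm i)]
    exact Finset.single_le_sum (f := fun j => M.p j / m j) (fun j _ => hterm j)
      (Finset.mem_univ i)
  refine ⟨(∑ i, M.p i) * a, δ, D * D', hδ, mul_nonneg hD hD', fun t c ht hc hf => ?_⟩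
  rw [inner_map_eq_sum, realAggregateUtility, Finset.mul_sum, Finset.mul_sum, Finset.mul_sum,
    Finset.sum_mul, Finset.sum_mul, ← Finset.sum_add_distrib]
  refine Finset.sum_le_sum fun i _ => ?_
  have h1 := mul_le_mul_of_nonneg_left (h t (c i) ht (hc i) fun hγ => hf hγ i) (hp i).le
  have h2 : 0 ≤ D * (Real.exp (-lam * t) * c i) :=
    mul_nonneg hD (mul_nonneg (Real.exp_pos _).le (hc i))
  have h3 := mul_le_mul_of_nonneg_right (hD'p i) h2
  calc _ = M.p i * (Real.exp (-M.ρ * t) * realUtility M.γ (c i)) := by ring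
    _ ≤ M.p i * (a * Real.exp (-δ * t) + D * (Real.exp (-lam * t) * c i)) := h1
    _ = M.p i * a * Real.exp (-δ * t) + M.p i * (D * (Real.exp (-lam * t) * c i)) := by ring
    _ ≤ M.p i * a * Real.exp (-δ * t) + D' * m i * (D * (Real.exp (-lam * t) * c i)) := by
      linarith
    _ = _ := by ring

end GrowthModel

/-! ### Integrals of extended real valued functions. -/

theorem integralNonneg_mono {f g : ℝ → EReal}
    (h : ∀ᵐ t ∂volume.restrict (Ici (0 : ℝ)), f t ≤ g t) :
    integralNonneg f ≤ integralNonneg g := by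
  refine EReal.sub_le_sub ?_ ?_
  · refine EReal.coe_ennreal_le_coe_ennreal_iff.2 (lintegral_mono_ae ?_)
    filter_upwards [h] with t ht using EReal.toENNReal_le_toENNReal ht
  · refine EReal.coe_ennreal_le_coe_ennreal_iff.2 (lintegral_mono_ae ?_)
    filter_upwards [h] with t ht using
      EReal.toENNReal_le_toENNReal (EReal.neg_le_neg_iff.2 ht)

theorem integralNonneg_congr {f g : ℝ → EReal}
    (h : ∀ᵐ t ∂volume.restrict (Ici (0 : ℝ)), f t = g t) :
    integralNonneg f = integralNonneg g :=
  le_antisymm (integralNonneg_mono (h.mono fun _ ht => ht.le))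
    (integralNonneg_mono (h.mono fun _ ht => ht.ge))

theorem integralNonneg_coe {g : ℝ → ℝ} (hg : IntegrableOn g (Ici 0)) :
    integralNonneg (fun t => (g t : EReal)) = ((∫ t in Ici (0 : ℝ), g t : ℝ) : EReal) := by
  have h1 : (∫⁻ t in Ici (0 : ℝ), ENNReal.ofReal (g t)) ≠ ⊤ := hg.lintegral_lt_top.ne
  have h2 : (∫⁻ t in Ici (0 : ℝ), ENNReal.ofReal (-g t)) ≠ ⊤ := hg.neg.lintegral_lt_top.ne
  unfold integralNonneg
  simp only [← EReal.coe_neg, EReal.real_coe_toENNReal]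
  rw [integral_eq_lintegral_pos_part_sub_lintegral_neg_part hg, EReal.coe_sub,
    EReal.coe_ennreal_toReal h1, EReal.coe_ennreal_toReal h2]

/-- If `f` is bounded above by an integrable function and its integral is not `-∞`, then `f` is
almost everywhere equal to an integrable real-valued function. -/
theorem integrableOn_toReal_of_integralNonneg_ne_bot {f : ℝ → EReal} {h : ℝ → ℝ}
    (hf : AEMeasurable f (volume.restrict (Ici 0))) (hh : IntegrableOn h (Ici 0))
    (hle : ∀ᵐ t ∂volume.restrict (Ici (0 : ℝ)), f t ≤ (h t : EReal))
    (hbot : integralNonneg f ≠ ⊥) :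
    IntegrableOn (fun t => (f t).toReal) (Ici 0) ∧
      ∀ᵐ t ∂volume.restrict (Ici (0 : ℝ)), f t ≠ ⊥ ∧ ((f t).toReal : EReal) = f t := by
  have hpos : (∫⁻ t in Ici (0 : ℝ), (f t).toENNReal) ≠ ⊤ := by
    refine ne_top_of_le_ne_top hh.lintegral_lt_top.ne (lintegral_mono_ae ?_)
    filter_upwards [hle] with t ht
    rw [← EReal.real_coe_toENNReal]
    exact EReal.toENNReal_le_toENNReal ht
  have hneg : (∫⁻ t in Ici (0 : ℝ), (-f t).toENNReal) ≠ ⊤ := by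
    -- In `EReal`, subtracting `⊤` gives `⊥` whatever the first term is, so an infinite negative
    -- part already makes the integral `⊥`.
    intro htop
    apply hbot
    rw [integralNonneg, htop, EReal.coe_ennreal_top, EReal.sub_top]
  have hfin : ∀ᵐ t ∂volume.restrict (Ici (0 : ℝ)),
      f t ≠ ⊥ ∧ ((f t).toReal : EReal) = f t := by
    have hm : AEMeasurable (fun t => (-f t).toENNReal) (volume.restrict (Ici (0 : ℝ))) :=
      (measurable_ereal_toENNReal.comp measurable_neg).comp_aemeasurable hf
    filter_upwards [ae_lt_top' hm hneg, hle] with t ht hle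
    have hb : f t ≠ ⊥ := by
      intro hb
      simp [hb] at ht
    exact ⟨hb, EReal.coe_toReal (ne_top_of_le_ne_top (EReal.coe_ne_top _) hle) hb⟩
  refine ⟨⟨hf.ereal_toReal.aestronglyMeasurable, ?_⟩, hfin⟩
  rw [hasFiniteIntegral_iff_enorm]
  refine lt_of_le_of_lt (lintegral_mono_ae
    (g := fun t => (f t).toENNReal + (-f t).toENNReal) ?_) ?_
  · filter_upwards [hfin] with t ht
    rw [← ht.2, ← EReal.coe_neg, EReal.real_coe_toENNReal, EReal.real_coe_toENNReal,
      EReal.toReal_coe, Real.enorm_eq_ofReal_abs]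
    rcases le_total 0 (f t).toReal with h0 | h0
    · rw [abs_of_nonneg h0]
      exact le_self_add
    · rw [abs_of_nonpos h0]
      exact le_add_self
  · rw [lintegral_add_left' (by exact measurable_ereal_toENNReal.comp_aemeasurable hf)]
    exact ENNReal.add_lt_top.2 ⟨hpos.lt_top, hneg.lt_top⟩

/-! ### Upper bound on the gain and nearly optimal controls. -/

namespace GrowthModel

variable {n : ℕ} {M : GrowthModel n} {k : EuclideanSpace ℝ (Fin n)}
  {C : ℝ → EuclideanSpace ℝ (Fin n)}

theorem coe_exp_mul_aggregateUtility {c : EuclideanSpace ℝ (Fin n)} (h : M.FiniteUtility c)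
    (t : ℝ) : ((Real.exp (-M.ρ * t) : ℝ) : EReal) * M.aggregateUtility c =
      ((Real.exp (-M.ρ * t) * M.realAggregateUtility c : ℝ) : EReal) := by
  rw [aggregateUtility_eq_coe h, EReal.coe_mul]

theorem exp_mul_aggregateUtility_eq_bot (hp : ∀ i, 0 < M.p i) {c : EuclideanSpace ℝ (Fin n)}
    (h : ¬ M.FiniteUtility c) (t : ℝ) :
    ((Real.exp (-M.ρ * t) : ℝ) : EReal) * M.aggregateUtility c = ⊥ := by
  rw [aggregateUtility_eq_bot hp h, EReal.coe_mul_bot_of_pos (Real.exp_pos _)]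

/-- The integrand is nonnegative and its integrals over `[0, T]` are bounded by `⟨b, k⟩` uniformly
in `T`; let `T → ∞`. -/
theorem integrableOn_inner_consumption (hN : ∀ x ∈ closedOrthant n, M.N x ∈ closedOrthant n)
    {lam : ℝ} {b : EuclideanSpace ℝ (Fin n)} (hb : b ∈ closedOrthant n)
    (hbeig : ContinuousLinearMap.adjoint M.drift b = lam • b) (hC : C ∈ M.admissible k) :
    IntegrableOn (fun t => Real.exp (-lam * t) * ⟪b, M.N (C t)⟫_ℝ) (Ici 0) ∧
      ∫ t in Ici (0 : ℝ), Real.exp (-lam * t) * ⟪b, M.N (C t)⟫_ℝ ≤ ⟪b, k⟫_ℝ := by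
  have hC' := hC
  obtain ⟨hCi, hCp, K, hK, hKp⟩ := hC
  have hint : ∀ T : ℝ, 0 ≤ T →
      IntervalIntegrable (fun t => Real.exp (-lam * t) * ⟪b, M.N (C t)⟫_ℝ) volume 0 T := by
    intro T hT
    have h1 := intervalIntegrable_of_admissible hC' le_rfl hT
    have h2 : IntervalIntegrable (fun t => ⟪b, M.N (C t)⟫_ℝ) volume 0 T :=
      ⟨((innerSL ℝ b).comp M.N).integrable_comp h1.1, ((innerSL ℝ b).comp M.N).integrable_comp h1.2⟩
    exact h2.continuousOn_mul (by fun_prop)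
  have hnn : ∀ t ∈ Ici (0 : ℝ), 0 ≤ Real.exp (-lam * t) * ⟪b, M.N (C t)⟫_ℝ := fun t ht =>
    mul_nonneg (Real.exp_pos _).le (inner_nonneg_of_mem_closedOrthant hb (hN _ (hCp t ht)))
  have hbd : ∀ T : ℝ, 0 ≤ T →
      ∫ t in (0 : ℝ)..T, Real.exp (-lam * t) * ⟪b, M.N (C t)⟫_ℝ ≤ ⟪b, k⟫_ℝ := fun T hT =>
    M.integral_exp_inner_le hb hbeig hCi hK hT (hKp T hT)
  have htend : Tendsto (fun i : ℕ => (i : ℝ)) atTop atTop := tendsto_natCast_atTop_atTop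
  have hI : IntegrableOn (fun t => Real.exp (-lam * t) * ⟪b, M.N (C t)⟫_ℝ) (Ioi 0) := by
    refine integrableOn_Ioi_of_intervalIntegral_norm_bounded ⟪b, k⟫_ℝ 0
      (b := fun i : ℕ => (i : ℝ)) (fun i => (hint i (Nat.cast_nonneg i)).1) htend
      (Eventually.of_forall fun i => ?_)
    refine le_trans (le_of_eq ?_) (hbd i (Nat.cast_nonneg i))
    apply intervalIntegral.integral_congr
    intro t ht
    rw [uIcc_of_le (Nat.cast_nonneg i)] at ht
    exact Real.norm_of_nonneg (hnn t ht.1)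
  refine ⟨(integrableOn_Ici_iff_integrableOn_Ioi (by finiteness)).2 hI, ?_⟩
  rw [integral_Ici_eq_integral_Ioi]
  exact le_of_tendsto (intervalIntegral_tendsto_integral_Ioi 0 hI htend)
    (Eventually.of_forall fun i => hbd i (Nat.cast_nonneg i))

/-- The standing assumptions on the model, in the form in which they are used. -/
structure Standing (M : GrowthModel n) (ν lam : ℝ) (b : EuclideanSpace ℝ (Fin n)) : Prop where
  p_pos : ∀ i, 0 < M.p i
  ρ_pos : 0 < M.ρ
  γ_pos : 0 < M.γ
  shift_nonneg : 0 ≤ ν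
  shift : ∀ x ∈ closedOrthant n, M.drift x + ν • x ∈ closedOrthant n
  N_nonneg : ∀ x ∈ closedOrthant n, M.N x ∈ closedOrthant n
  N_single_ne : ∀ i, M.N (EuclideanSpace.single i 1) ≠ 0
  lam_pos : 0 < lam
  b_pos : b ∈ openOrthant n
  eig : ContinuousLinearMap.adjoint M.drift b = lam • b
  lam_lt : lam * (1 - M.γ) < M.ρ

variable {ν lam : ℝ} {b : EuclideanSpace ℝ (Fin n)}

/-- The discounted utility of an admissible control is bounded above by an integrable function,
whose integral is bounded independently of the control. -/
theorem Standing.exists_upper_bound (H : M.Standing ν lam b) (k : EuclideanSpace ℝ (Fin n)) :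
    ∃ R : ℝ, ∀ C ∈ M.admissible k, ∃ h : ℝ → ℝ, IntegrableOn h (Ici 0) ∧
      ∫ t in Ici (0 : ℝ), h t ≤ R ∧ ∀ᵐ t ∂volume.restrict (Ici (0 : ℝ)),
        ((Real.exp (-M.ρ * t) : ℝ) : EReal) * M.aggregateUtility (C t) ≤ (h t : EReal) := by
  obtain ⟨a, δ, D, hδ, hD, hle⟩ := exists_discounted_realAggregateUtility_le H.p_pos H.ρ_pos
    H.γ_pos H.N_nonneg H.N_single_ne H.lam_pos H.b_pos H.lam_lt
  have h1 : IntegrableOn (fun t => a * Real.exp (-δ * t)) (Ici 0) :=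
    ((integrableOn_Ici_iff_integrableOn_Ioi (by finiteness)).2 (exp_neg_integrableOn_Ioi 0 hδ)).const_mul a
  refine ⟨(∫ t in Ici (0 : ℝ), a * Real.exp (-δ * t)) + D * ⟪b, k⟫_ℝ, fun C hC => ?_⟩
  obtain ⟨h2, h3⟩ := integrableOn_inner_consumption H.N_nonneg
    (openOrthant_subset_closedOrthant H.b_pos) H.eig hC
  have h4 : IntegrableOn (fun t => D * (Real.exp (-lam * t) * ⟪b, M.N (C t)⟫_ℝ)) (Ici 0) :=
    Integrable.const_mul h2 D
  refine ⟨fun t => a * Real.exp (-δ * t) + D * (Real.exp (-lam * t) * ⟪b, M.N (C t)⟫_ℝ),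
    Integrable.add h1 h4, ?_, ?_⟩
  · rw [integral_add h1 h4, integral_const_mul D]
    exact add_le_add le_rfl (mul_le_mul_of_nonneg_left h3 hD)
  · filter_upwards [ae_restrict_mem measurableSet_Ici] with t ht
    by_cases hf : M.FiniteUtility (C t)
    · rw [coe_exp_mul_aggregateUtility hf]
      exact EReal.coe_le_coe_iff.2 (hle t _ ht (hC.2.1 t ht) hf)
    · rw [exp_mul_aggregateUtility_eq_bot H.p_pos hf]
      exact bot_le

theorem Standing.value_ne_top (H : M.Standing ν lam b) (k : EuclideanSpace ℝ (Fin n)) :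
    M.value k ≠ ⊤ := by
  obtain ⟨R, hR⟩ := H.exists_upper_bound k
  have : M.value k ≤ (R : EReal) := by
    refine iSup₂_le fun C hC => ?_
    obtain ⟨h, hh, hle, hb⟩ := hR C hC
    refine (integralNonneg_mono hb).trans ?_
    rw [integralNonneg_coe hh]
    exact EReal.coe_le_coe_iff.2 hle
  exact ne_top_of_le_ne_top (EReal.coe_ne_top R) this

theorem coe_integral_le_value {g : ℝ → ℝ} (hC : C ∈ M.admissible k)
    (hg : IntegrableOn g (Ici 0)) (hle : ∀ᵐ t ∂volume.restrict (Ici (0 : ℝ)),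
      M.FiniteUtility (C t) ∧ g t ≤ Real.exp (-M.ρ * t) * M.realAggregateUtility (C t)) :
    ((∫ t in Ici (0 : ℝ), g t : ℝ) : EReal) ≤ M.value k := by
  refine le_trans ?_ (le_iSup₂ (f := fun C (_ : C ∈ M.admissible k) => M.gain C) C hC)
  rw [← integralNonneg_coe hg]
  refine integralNonneg_mono ?_
  filter_upwards [hle] with t ht
  rw [coe_exp_mul_aggregateUtility ht.1]
  exact EReal.coe_le_coe_iff.2 ht.2

theorem Standing.integral_le_toReal_value {g : ℝ → ℝ} (H : M.Standing ν lam b)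
    (hC : C ∈ M.admissible k)
    (hg : IntegrableOn g (Ici 0)) (hle : ∀ᵐ t ∂volume.restrict (Ici (0 : ℝ)),
      M.FiniteUtility (C t) ∧ g t ≤ Real.exp (-M.ρ * t) * M.realAggregateUtility (C t)) :
    M.value k ≠ ⊥ ∧ ∫ t in Ici (0 : ℝ), g t ≤ (M.value k).toReal := by
  have h := coe_integral_le_value hC hg hle
  have hb : M.value k ≠ ⊥ := ne_bot_of_le_ne_bot (EReal.coe_ne_bot _) h
  exact ⟨hb, by rwa [← EReal.coe_le_coe_iff, EReal.coe_toReal (H.value_ne_top k) hb]⟩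

/-- The gain of a nearly optimal control is not `⊥`, and its integrand has an integrable upper
bound, so it is almost everywhere real and integrable. This allows the remaining arguments to use
ordinary real integrals. -/
theorem Standing.exists_control (H : M.Standing ν lam b) (hk : M.value k ≠ ⊥) {ε : ℝ}
    (hε : 0 < ε) :
    ∃ C ∈ M.admissible k,
      IntegrableOn (fun t => Real.exp (-M.ρ * t) * M.realAggregateUtility (C t)) (Ici 0) ∧
      (∀ᵐ t ∂volume.restrict (Ici (0 : ℝ)), M.FiniteUtility (C t)) ∧
      (M.value k).toReal - ε <
        ∫ t in Ici (0 : ℝ), Real.exp (-M.ρ * t) * M.realAggregateUtility (C t) := by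
  have hlt : (((M.value k).toReal - ε : ℝ) : EReal) < M.value k := by
    conv_rhs => rw [← EReal.coe_toReal (H.value_ne_top k) hk]
    exact EReal.coe_lt_coe_iff.2 (by linarith)
  obtain ⟨C, hC, hCgt⟩ : ∃ C ∈ M.admissible k,
      (((M.value k).toReal - ε : ℝ) : EReal) < M.gain C := by
    simpa only [value, lt_iSup_iff, exists_prop] using hlt
  obtain ⟨R, hR⟩ := H.exists_upper_bound k
  obtain ⟨h, hh, -, hb⟩ := hR C hC
  have hCm : AEMeasurable C (volume.restrict (Ici 0)) := hC.1.aestronglyMeasurable.aemeasurable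
  have hm : AEMeasurable (fun t => ((Real.exp (-M.ρ * t) : ℝ) : EReal) *
      M.aggregateUtility (C t)) (volume.restrict (Ici 0)) :=
    AEMeasurable.mul (by fun_prop) (measurable_aggregateUtility.comp_aemeasurable hCm)
  obtain ⟨hi, hfin⟩ := integrableOn_toReal_of_integralNonneg_ne_bot hm hh hb
    (ne_bot_of_gt hCgt)
  have hF : ∀ᵐ t ∂volume.restrict (Ici (0 : ℝ)), M.FiniteUtility (C t) := by
    filter_upwards [hfin] with t ht
    by_contra hf
    exact ht.1 (exp_mul_aggregateUtility_eq_bot H.p_pos hf t)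
  have hI : IntegrableOn (fun t => Real.exp (-M.ρ * t) * M.realAggregateUtility (C t))
      (Ici 0) := by
    refine Integrable.congr hi ?_
    filter_upwards [hF] with t ht
    rw [coe_exp_mul_aggregateUtility ht, EReal.toReal_coe]
  refine ⟨C, hC, hI, hF, ?_⟩
  rw [← EReal.coe_lt_coe_iff, ← integralNonneg_coe hI]
  refine hCgt.trans_le (le_of_eq (integralNonneg_congr ?_))
  filter_upwards [hF] with t ht
  exact coe_exp_mul_aggregateUtility ht t

end GrowthModel

/-! ### Translation of integrals on half-lines. -/

section Shift

theorem preimage_add_const_Ici_self (t : ℝ) : (fun s : ℝ => s + t) ⁻¹' Ici t = Ici 0 := by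
  ext s; simp

theorem integrableOn_Ici_comp_add {g : ℝ → ℝ} {t : ℝ} :
    IntegrableOn (fun s => g (s + t)) (Ici 0) ↔ IntegrableOn g (Ici t) := by
  rw [← preimage_add_const_Ici_self t]
  exact (measurePreserving_add_right volume t).integrableOn_comp_preimage
    (measurableEmbedding_addRight t)

theorem setIntegral_Ici_comp_add (g : ℝ → ℝ) (t : ℝ) :
    ∫ s in Ici (0 : ℝ), g (s + t) = ∫ s in Ici t, g s := by
  rw [← preimage_add_const_Ici_self t]
  exact (measurePreserving_add_right volume t).setIntegral_preimage_emb
    (measurableEmbedding_addRight t) g _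

theorem ae_Ici_comp_add {p : ℝ → Prop} {a t : ℝ}
    (h : ∀ᵐ s ∂volume.restrict (Ici a), p s) :
    ∀ᵐ s : ℝ, a ≤ s + t → p (s + t) := by
  rw [ae_restrict_iff' measurableSet_Ici] at h
  exact (measurePreserving_add_right volume t).quasiMeasurePreserving.ae h

theorem setIntegral_Ici_eq_add {g : ℝ → ℝ} {t : ℝ} (ht : 0 ≤ t) (hg : IntegrableOn g (Ici 0)) :
    ∫ s in Ici (0 : ℝ), g s = (∫ s in (0 : ℝ)..t, g s) + ∫ s in Ici t, g s := by
  rw [integral_Ici_eq_integral_Ioi, integral_Ici_eq_integral_Ioi]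
  exact (intervalIntegral.integral_interval_add_Ioi
    (hg.mono_set Ioi_subset_Ici_self)
    (hg.mono_set (Ioi_subset_Ici_self.trans (Ici_subset_Ici.2 ht)))).symm

end Shift

/-! ### Concavity, finiteness and dynamic programming for the value function. -/

namespace GrowthModel

variable {n : ℕ} {M : GrowthModel n} {k x y c : EuclideanSpace ℝ (Fin n)}
  {C K : ℝ → EuclideanSpace ℝ (Fin n)} {ν lam : ℝ} {b : EuclideanSpace ℝ (Fin n)}

theorem Standing.value_mono (H : M.Standing ν lam b) (h : y - x ∈ closedOrthant n) :
    M.value x ≤ M.value y :=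
  iSup₂_le fun C hC => le_iSup₂ (f := fun C (_ : C ∈ M.admissible y) => M.gain C) C
    (admissible_mono H.shift h hC)

/-- Concavity of the value function on its effective domain. -/
theorem Standing.value_concave (H : M.Standing ν lam b) (hx : M.value x ≠ ⊥)
    (hy : M.value y ≠ ⊥) {s r : ℝ} (hs : 0 ≤ s) (hr : 0 ≤ r) (hsr : s + r = 1) :
    M.value (s • x + r • y) ≠ ⊥ ∧
      s * (M.value x).toReal + r * (M.value y).toReal ≤ (M.value (s • x + r • y)).toReal := by
  have key : ∀ ε : ℝ, 0 < ε → M.value (s • x + r • y) ≠ ⊥ ∧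
      s * (M.value x).toReal + r * (M.value y).toReal ≤
        (M.value (s • x + r • y)).toReal + ε := by
    intro ε hε
    obtain ⟨C₁, hC₁, i₁, f₁, l₁⟩ := H.exists_control hx hε
    obtain ⟨C₂, hC₂, i₂, f₂, l₂⟩ := H.exists_control hy hε
    have i₁' := Integrable.const_mul i₁ s
    have i₂' := Integrable.const_mul i₂ r
    obtain ⟨h1, h2⟩ := H.integral_le_toReal_value (add_smul_mem_admissible hC₁ hC₂ hs hr)
      (Integrable.add i₁' i₂') (by
        filter_upwards [f₁, f₂, ae_restrict_mem measurableSet_Ici] with t h1 h2 ht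
        have p1 := hC₁.2.1 t ht
        have p2 := hC₂.2.1 t ht
        refine ⟨finiteUtility_convex p1 p2 h1 h2 hs hr hsr, ?_⟩
        have h3 := mul_le_mul_of_nonneg_left
          (realAggregateUtility_concave H.p_pos H.γ_pos p1 p2 h1 h2 hs hr hsr)
          (Real.exp_pos (-M.ρ * t)).le
        simp only [Pi.add_apply]
        linarith)
    refine ⟨h1, ?_⟩
    simp only [Pi.add_apply] at h2
    rw [integral_add i₁' i₂', integral_const_mul, integral_const_mul] at h2
    have e1 := mul_le_mul_of_nonneg_left l₁.le hs
    have e2 := mul_le_mul_of_nonneg_left l₂.le hr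
    have e3 : s * ε + r * ε = ε := by rw [← add_mul, hsr, one_mul]
    linarith
  exact ⟨(key 1 one_pos).1, le_of_forall_pos_le_add fun ε hε => (key ε hε).2⟩

theorem realAggregateUtility_smul (hγ : M.γ ≠ 1) (hc : c ∈ closedOrthant n) {a : ℝ}
    (ha : 0 ≤ a) :
    M.realAggregateUtility (a • c) = a ^ (1 - M.γ) * M.realAggregateUtility c := by
  simp only [realAggregateUtility, realUtility, if_neg hγ, Finset.mul_sum]
  refine Finset.sum_congr rfl fun i _ => ?_
  rw [PiLp.smul_apply, smul_eq_mul, Real.mul_rpow ha (hc i)]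
  ring

theorem finiteUtility_smul (hc : M.FiniteUtility c) {a : ℝ} (ha : a ≠ 0) :
    M.FiniteUtility (a • c) := fun hγ i => mul_ne_zero ha (hc hγ i)

theorem Standing.value_smul_ne_bot (H : M.Standing ν lam b) (hγ : M.γ ≠ 1)
    (hx : M.value x ≠ ⊥) {a : ℝ} (ha : 0 < a) : M.value (a • x) ≠ ⊥ := by
  obtain ⟨C, hC, i, f, -⟩ := H.exists_control hx one_pos
  refine (H.integral_le_toReal_value (smul_mem_admissible hC ha.le)
    (Integrable.const_mul i (a ^ (1 - M.γ))) ?_).1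
  filter_upwards [f, ae_restrict_mem measurableSet_Ici] with t h1 ht
  refine ⟨finiteUtility_smul h1 ha.ne', ?_⟩
  rw [realAggregateUtility_smul hγ (hC.2.1 t ht) ha.le]
  exact le_of_eq (by ring)

/-- An exponentially decaying consumption is admissible in the open orthant. -/
theorem Standing.exists_exp_control (H : M.Standing ν lam b) (hk : k ∈ openOrthant n)
    (c : EuclideanSpace ℝ (Fin n)) (hc : c ∈ closedOrthant n) :
    ∃ a r : ℝ, 0 < a ∧ (fun t : ℝ => Real.exp (-r * t) • a • c) ∈ M.admissible k := by
  -- The path is sought as `e^{-rt}k + D(t)` with `D(0) = 0`. Then `D` is driven by `e^{-rt}(Bk + rk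
  -- - aNc)`, which is nonnegative because `Bk + νk ≥ 0` and, for small `a`, `k - aNc ≥ 0`; the
  -- extra 1 in `r` pays for the consumption.
  set r := ν + 1 with hr
  obtain ⟨a, ha, hac⟩ := exists_pos_smul_le hk (M.N c)
  refine ⟨a, r, ha, ?_⟩
  have hforce : M.drift k + r • k - a • M.N c ∈ closedOrthant n := by
    have := closedOrthant_add (H.shift k (openOrthant_subset_closedOrthant hk)) hac
    convert this using 1
    rw [hr, add_smul, one_smul]; abel
  have hg : Continuous fun t : ℝ =>
      Real.exp (-r * t) • (M.drift k + r • k - a • M.N c) := by fun_prop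
  obtain ⟨D, hD, hD0, hDf⟩ := exists_forced_solution M.drift hg 0
  have hDp : ∀ t, 0 ≤ t → D t ∈ closedOrthant n := by
    intro t ht i
    rw [hDf t, map_zero, zero_add]
    have hc1 : Continuous fun s : ℝ => NormedSpace.exp ((t - s) • M.drift)
        (Real.exp (-r * s) • (M.drift k + r • k - a • M.N c)) :=
      ((continuous_exp_smul M.drift).comp (by fun_prop : Continuous fun s : ℝ => t - s)).clm_apply
        hg
    have h1 := (EuclideanSpace.proj (𝕜 := ℝ) i).intervalIntegral_comp_comm
      (hc1.intervalIntegrable (μ := volume) 0 t)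
    refine le_of_le_of_eq ?_ h1
    refine intervalIntegral.integral_nonneg ht fun s hs => ?_
    exact exp_smul_apply_mem_closedOrthant H.shift (sub_nonneg.2 hs.2)
      (closedOrthant_smul (Real.exp_pos _).le hforce) i
  have hcont : Continuous fun t : ℝ => Real.exp (-r * t) • a • c := by fun_prop
  refine ⟨hcont.locallyIntegrable.locallyIntegrableOn _, fun t _ =>
    closedOrthant_smul (Real.exp_pos _).le (closedOrthant_smul ha.le hc),
    fun t => Real.exp (-r * t) • k + D t, M.isCapitalPath_of_hasDerivAt hcont (fun t => ?_)
      (by simp [hD0]), fun t ht =>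
    closedOrthant_add (closedOrthant_smul (Real.exp_pos _).le
      (openOrthant_subset_closedOrthant hk)) (hDp t ht)⟩
  have h1 : HasDerivAt (fun s : ℝ => -r * s) (-r) t := by
    simpa using (hasDerivAt_id t).const_mul (-r)
  refine ((h1.exp.smul_const k).add (hD t)).congr_deriv ?_
  simp only [map_add, map_smul, smul_sub, smul_add, mul_smul, neg_smul, smul_neg]
  abel

/-- For `γ < 1` zero consumption has nonnegative utility. For `γ = 1` an exponentially decaying
consumption has a logarithm affine in time, which the discount makes integrable. For `γ > 1` a point
of finite value can be scaled down below `k`; homogeneity and monotonicity finish. -/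
theorem Standing.value_ne_bot (H : M.Standing ν lam b)
    (hV : 1 < M.γ → ∃ k ∈ closedOrthant n, M.value k ≠ ⊥) (hk : k ∈ openOrthant n) :
    M.value k ≠ ⊥ := by
  rcases lt_trichotomy M.γ 1 with hγ | hγ | hγ
  · refine (H.integral_le_toReal_value (g := fun _ => 0)
      (zero_mem_admissible H.shift (openOrthant_subset_closedOrthant hk)) (by simp)
      (Eventually.of_forall fun t => ⟨fun h => absurd h (not_le.2 hγ), ?_⟩)).1
    refine mul_nonneg (Real.exp_pos _).le (Finset.sum_nonneg fun i _ => mul_nonneg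
      (H.p_pos i).le ?_)
    rw [realUtility, if_neg hγ.ne]
    exact div_nonneg (Real.rpow_nonneg le_rfl _) (by linarith)
  · have h1 : (WithLp.toLp 2 fun _ => 1 : EuclideanSpace ℝ (Fin n)) ∈ closedOrthant n :=
      fun i => zero_le_one
    obtain ⟨a, r, ha, hC⟩ := H.exists_exp_control hk _ h1
    have hU : ∀ t : ℝ, M.realAggregateUtility
        (Real.exp (-r * t) • a • (WithLp.toLp 2 fun _ => 1 : EuclideanSpace ℝ (Fin n))) =
        (∑ i, M.p i) * (Real.log a - r * t) := by
      intro t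
      rw [realAggregateUtility, Finset.sum_mul]
      refine Finset.sum_congr rfl fun i _ => ?_
      simp only [realUtility, if_pos hγ, PiLp.smul_apply, smul_eq_mul, mul_one]
      rw [Real.log_mul (Real.exp_pos _).ne' ha.ne', Real.log_exp]
      ring
    have hρ := H.ρ_pos
    have hexp : IntegrableOn (fun t => Real.exp (-M.ρ * t)) (Ici 0) :=
      (integrableOn_Ici_iff_integrableOn_Ioi (by finiteness)).2 (exp_neg_integrableOn_Ioi 0 hρ)
    have hexp2 : IntegrableOn (fun t => t * Real.exp (-M.ρ * t)) (Ici 0) := by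
      refine (integrableOn_Ici_iff_integrableOn_Ioi (by finiteness)).2 ?_
      have := integrableOn_rpow_mul_exp_neg_mul_rpow (s := 1) (p := 1) (b := M.ρ) (by norm_num)
        one_pos hρ
      simpa using this
    have hint : IntegrableOn (fun t => Real.exp (-M.ρ * t) *
        ((∑ i, M.p i) * (Real.log a - r * t))) (Ici 0) := by
      have h := (Integrable.const_mul hexp ((∑ i, M.p i) * Real.log a)).sub
        (Integrable.const_mul hexp2 ((∑ i, M.p i) * r))
      refine Integrable.congr h (Eventually.of_forall fun t => ?_)
      simp only [Pi.sub_apply]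
      ring
    refine (H.integral_le_toReal_value hC hint (Eventually.of_forall fun t => ⟨?_, ?_⟩)).1
    · intro _ i
      simpa using ha.ne'
    · rw [hU]
  · obtain ⟨k₀, -, hk₀⟩ := hV hγ
    obtain ⟨a, ha, hak⟩ := exists_pos_smul_le hk k₀
    exact ne_bot_of_le_ne_bot (H.value_smul_ne_bot hγ.ne' hk₀ ha) (H.value_mono hak)

/-- Dynamic programming, the inequality for nearly optimal controls. -/
theorem Standing.exists_control_dpp (H : M.Standing ν lam b) (hk : M.value k ≠ ⊥) {ε t : ℝ}
    (hε : 0 < ε) (ht : 0 ≤ t) :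
    ∃ C ∈ M.admissible k, ∃ K, M.IsCapitalPath (Ici 0) k C K ∧ K t ∈ closedOrthant n ∧
      M.value (K t) ≠ ⊥ ∧
      IntervalIntegrable (fun s => Real.exp (-M.ρ * s) * M.realAggregateUtility (C s))
        volume 0 t ∧
      (∀ᵐ s ∂volume.restrict (Ici (0 : ℝ)), M.FiniteUtility (C s)) ∧
      (M.value k).toReal - ε <
        (∫ s in (0 : ℝ)..t, Real.exp (-M.ρ * s) * M.realAggregateUtility (C s)) +
          Real.exp (-M.ρ * t) * (M.value (K t)).toReal := by
  obtain ⟨C, hC, hi, hf, hgt⟩ := H.exists_control hk hε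
  obtain ⟨-, -, K, hK, hKp⟩ := id hC
  set G : ℝ → ℝ := fun s => Real.exp (-M.ρ * s) * M.realAggregateUtility (C s) with hG
  -- The tail of `C` competes in the problem started at `K t`; the factor `e^{ρt}` restarts its
  -- discounting at time 0.
  have hG2 : IntegrableOn (fun s => Real.exp (M.ρ * t) * G (s + t)) (Ici 0) :=
    Integrable.const_mul (integrableOn_Ici_comp_add.2 (hi.mono_set (Ici_subset_Ici.2 ht))) _
  obtain ⟨h1, h2⟩ := H.integral_le_toReal_value (shift_mem_admissible hC hK hKp ht) hG2 (by
    rw [ae_restrict_iff' measurableSet_Ici]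
    filter_upwards [ae_Ici_comp_add (t := t) hf] with s hs hs0
    refine ⟨hs (add_nonneg hs0 ht), le_of_eq ?_⟩
    rw [hG, ← mul_assoc, ← Real.exp_add]
    congr 2; ring)
  rw [integral_const_mul, setIntegral_Ici_comp_add] at h2
  refine ⟨C, hC, K, hK, hKp t ht, h1,
    (hi.mono_set (fun s hs => (uIcc_of_le ht ▸ hs : s ∈ Icc 0 t).1)).intervalIntegrable, hf, ?_⟩
  rw [setIntegral_Ici_eq_add ht hi] at hgt
  have h3 := mul_le_mul_of_nonneg_left h2 (Real.exp_pos (-M.ρ * t)).le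
  rw [← mul_assoc, ← Real.exp_add] at h3
  have e : -M.ρ * t + M.ρ * t = 0 := by ring
  rw [e, Real.exp_zero, one_mul] at h3
  linarith

theorem integral_exp_neg_mul {ρ : ℝ} (hρ : ρ ≠ 0) (t : ℝ) :
    ∫ s in (0 : ℝ)..t, Real.exp (-ρ * s) = (1 - Real.exp (-ρ * t)) / ρ := by
  have h : ∀ s ∈ uIcc 0 t, HasDerivAt (fun s => -Real.exp (-ρ * s) / ρ) (Real.exp (-ρ * s)) s := by
    intro s _
    have h1 : HasDerivAt (fun s : ℝ => -ρ * s) (-ρ) s := by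
      simpa using (hasDerivAt_id s).const_mul (-ρ)
    refine (h1.exp.neg.div_const ρ).congr_deriv ?_
    field_simp
  rw [intervalIntegral.integral_eq_sub_of_hasDerivAt h
    ((by fun_prop : Continuous fun s : ℝ => Real.exp (-ρ * s)).intervalIntegrable _ _)]
  simp
  ring

/-- Dynamic programming, the inequality along a constant control that leads to `k`. -/
theorem Standing.le_value_of_path (H : M.Standing ν lam b) (hk : M.value k ≠ ⊥) {t : ℝ}
    (ht : 0 ≤ t) (hc : c ∈ closedOrthant n) (hcf : M.FiniteUtility c)
    (hK : M.IsCapitalPath (Icc (-t) 0) k (fun _ => c) K)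
    (hpos : ∀ s ∈ Icc (-t) 0, K s ∈ closedOrthant n) :
    M.value (K (-t)) ≠ ⊥ ∧
      (1 - Real.exp (-M.ρ * t)) / M.ρ * M.realAggregateUtility c +
        Real.exp (-M.ρ * t) * (M.value k).toReal ≤ (M.value (K (-t))).toReal := by
  have key : ∀ ε : ℝ, 0 < ε → M.value (K (-t)) ≠ ⊥ ∧
      (1 - Real.exp (-M.ρ * t)) / M.ρ * M.realAggregateUtility c +
        Real.exp (-M.ρ * t) * (M.value k).toReal ≤ (M.value (K (-t))).toReal + ε := by
    intro ε hε
    obtain ⟨C, hC, hi, hf, hgt⟩ := H.exists_control hk hε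
    set G : ℝ → ℝ := fun s => Real.exp (-M.ρ * s) * M.realAggregateUtility (C s) with hG
    set g : ℝ → ℝ := fun s => if s ≤ t then Real.exp (-M.ρ * s) * M.realAggregateUtility c
      else Real.exp (-M.ρ * t) * G (s + -t) with hg
    have hshift : IntegrableOn (fun s => Real.exp (-M.ρ * t) * G (s + -t)) (Ici t) := by
      refine Integrable.const_mul ?_ _
      rw [← IntegrableOn, ← integrableOn_Ici_comp_add]
      simpa using hi
    have hIoi : IntegrableOn g (Ioi t) := by
      refine (hshift.mono_set Ioi_subset_Ici_self).congr_fun (fun s hs => ?_) measurableSet_Ioi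
      simp [hg, not_le.2 (mem_Ioi.1 hs)]
    have hIcc : IntegrableOn g (Icc 0 t) := by
      have h1 : IntegrableOn (fun s => Real.exp (-M.ρ * s) * M.realAggregateUtility c) (Icc 0 t) :=
        (by fun_prop : Continuous fun s => Real.exp (-M.ρ * s) * M.realAggregateUtility c
          ).continuousOn.integrableOn_Icc
      refine h1.congr_fun (fun s hs => ?_) measurableSet_Icc
      simp [hg, hs.2]
    have hgi : IntegrableOn g (Ici 0) := by
      have := hIcc.union hIoi
      rwa [Icc_union_Ioi_eq_Ici ht] at this
    obtain ⟨h1, h2⟩ := H.integral_le_toReal_value (concat_mem_admissible ht hc hK hpos hC) hgi (by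
      filter_upwards [ae_restrict_of_ae (ae_Ici_comp_add (t := -t) hf)] with s hs
      by_cases h : s ≤ t
      · simp [hg, h, hcf]
      · simp only [hg, h, if_false]
        refine ⟨by simpa [sub_eq_add_neg] using hs (by linarith), le_of_eq ?_⟩
        rw [hG, ← mul_assoc, ← Real.exp_add, sub_eq_add_neg]
        congr 2; ring)
    refine ⟨h1, ?_⟩
    have e1 : ∫ s in (0 : ℝ)..t, g s =
        (1 - Real.exp (-M.ρ * t)) / M.ρ * M.realAggregateUtility c := by
      rw [← integral_exp_neg_mul H.ρ_pos.ne', ← intervalIntegral.integral_mul_const]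
      refine intervalIntegral.integral_congr fun s hs => ?_
      rw [uIcc_of_le ht] at hs
      simp [hg, hs.2]
    have e2 : ∫ s in Ici t, g s = Real.exp (-M.ρ * t) * ∫ s in Ici (0 : ℝ), G s := by
      rw [integral_Ici_eq_integral_Ioi, ← integral_const_mul]
      have e3 := setIntegral_Ici_comp_add (fun s => Real.exp (-M.ρ * t) * G (s + -t)) t
      simp only [add_neg_cancel_right] at e3
      rw [e3, integral_Ici_eq_integral_Ioi]
      refine setIntegral_congr_fun measurableSet_Ioi fun s hs => ?_
      simp [hg, not_le.2 (mem_Ioi.1 hs)]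
    rw [setIntegral_Ici_eq_add ht hgi, e1, e2] at h2
    have h3 : Real.exp (-M.ρ * t) ≤ 1 :=
      Real.exp_le_one_iff.2 (by nlinarith [H.ρ_pos])
    have h4 := mul_le_mul_of_nonneg_left hgt.le (Real.exp_pos (-M.ρ * t)).le
    nlinarith
  exact ⟨(key 1 one_pos).1, le_of_forall_pos_le_add fun ε hε => (key ε hε).2⟩

end GrowthModel

/-! ### Supergradients and the two inequalities obtained in small time. -/

theorem tendsto_one_sub_exp_div (ρ : ℝ) :
    Tendsto (fun t : ℝ => (1 - Real.exp (-ρ * t)) / t) (𝓝[>] 0) (𝓝 ρ) := by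
  have h : HasDerivAt (fun t : ℝ => 1 - Real.exp (-ρ * t)) ρ 0 := by
    have h1 : HasDerivAt (fun s : ℝ => -ρ * s) (-ρ) 0 := by
      simpa using (hasDerivAt_id (0 : ℝ)).const_mul (-ρ)
    refine (h1.exp.const_sub 1).congr_deriv ?_
    simp
  have h2 := (hasDerivAt_iff_tendsto_slope.1 h).mono_left
    (nhdsWithin_mono 0 fun t (ht : 0 < t) => ht.ne')
  refine h2.congr fun t => ?_
  simp [slope_def_field]

theorem intervalIntegrable_inner {n : ℕ} {w f : ℝ → EuclideanSpace ℝ (Fin n)} {a b : ℝ}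
    (hw : Continuous w) (hf : IntervalIntegrable f volume a b) :
    IntervalIntegrable (fun t => ⟪w t, f t⟫_ℝ) volume a b := by
  have hi : ∀ i, IntervalIntegrable (fun t => w t i * f t i) volume a b := fun i => by
    have hfi : IntervalIntegrable (fun t => f t i) volume a b :=
      ⟨(EuclideanSpace.proj (𝕜 := ℝ) i).integrable_comp hf.1,
        (EuclideanSpace.proj (𝕜 := ℝ) i).integrable_comp hf.2⟩
    exact hfi.continuousOn_mul (by fun_prop)
  simp only [inner_eq_sum]
  exact ⟨integrable_finsetSum _ fun i _ => (hi i).1, integrable_finsetSum _ fun i _ => (hi i).2⟩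

namespace GrowthModel

variable {n : ℕ} {M : GrowthModel n} {k x y c q : EuclideanSpace ℝ (Fin n)}
  {K : ℝ → EuclideanSpace ℝ (Fin n)} {ν lam : ℝ} {b : EuclideanSpace ℝ (Fin n)}

/-- `q` is a supergradient of the value function at `k`, relative to the closed orthant. -/
def IsSupergradient (M : GrowthModel n) (k q : EuclideanSpace ℝ (Fin n)) : Prop :=
  ∀ x ∈ closedOrthant n, M.value x ≠ ⊥ →
    (M.value x).toReal ≤ (M.value k).toReal + ⟪q, x - k⟫_ℝ

theorem Standing.value_segment (H : M.Standing ν lam b) (hk : M.value k ≠ ⊥)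
    (hx : M.value x ≠ ⊥) {s : ℝ} (hs : 0 ≤ s) (hs1 : s ≤ 1) :
    M.value (k + s • (x - k)) ≠ ⊥ ∧
      (M.value k).toReal + s * ((M.value x).toReal - (M.value k).toReal) ≤
        (M.value (k + s • (x - k))).toReal := by
  have h := H.value_concave hk hx (sub_nonneg.2 hs1) hs (by ring)
  have e : (1 - s) • k + s • x = k + s • (x - k) := by
    rw [sub_smul, one_smul, smul_sub]; abel
  rw [e] at h
  exact ⟨h.1, by linarith [h.2]⟩

/-- By concavity, a first order upper bound along segments is a global upper bound. -/
theorem Standing.isSupergradient_of_segments (H : M.Standing ν lam b) (hk : M.value k ≠ ⊥)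
    (h : ∀ x ∈ closedOrthant n, M.value x ≠ ⊥ → ∀ ε : ℝ, 0 < ε → ∃ s : ℝ, 0 < s ∧ s ≤ 1 ∧
      (M.value (k + s • (x - k))).toReal ≤
        (M.value k).toReal + s * (⟪q, x - k⟫_ℝ + ε)) :
    M.IsSupergradient k q := by
  intro x hx hxv
  refine le_of_forall_pos_le_add fun ε hε => ?_
  obtain ⟨s, hs, hs1, hle⟩ := h x hx hxv ε hε
  have h1 := (H.value_segment hk hxv hs.le hs1).2
  have h2 : s * ((M.value x).toReal - (M.value k).toReal) ≤ s * (⟪q, x - k⟫_ℝ + ε) := by linarith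
  have h3 := le_of_mul_le_mul_left h2 hs
  linarith

theorem tendsto_segment (k d : EuclideanSpace ℝ (Fin n)) :
    Tendsto (fun s : ℝ => k + s • d) (𝓝[>] 0) (𝓝 k) := by
  have : Continuous fun s : ℝ => k + s • d := by fun_prop
  simpa using (this.tendsto 0).mono_left nhdsWithin_le_nhds

theorem Standing.isSupergradient_of_mem_superdifferential (H : M.Standing ν lam b)
    (hk : k ∈ closedOrthant n) (hq : q ∈ superdifferential (closedOrthant n) M.value k) :
    M.IsSupergradient k q := by
  obtain ⟨hk1, hk2, hlim⟩ := hq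
  refine H.isSupergradient_of_segments hk1 fun x hx hxv ε hε => ?_
  by_cases hxk : x = k
  · exact ⟨1, one_pos, le_rfl, by simpa [hxk] using hε.le⟩
  have hd : 0 < ‖x - k‖ := norm_pos_iff.2 (sub_ne_zero.2 hxk)
  -- The quotient is normalised by the length `s * ‖x - k‖` of the displacement, so the threshold `ε
  -- / ‖x - k‖` yields the error `s * ε`.
  have hev := eventually_lt_of_limsup_lt (lt_of_le_of_lt hlim
    (EReal.coe_pos.2 (div_pos hε hd)))
  have hle1 : ∀ᶠ s in 𝓝[>] (0 : ℝ), s ≤ 1 :=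
    (Iic_mem_nhds one_pos : Iic (1 : ℝ) ∈ 𝓝 0) |> mem_nhdsWithin_of_mem_nhds
  have htend : Tendsto (fun s : ℝ => k + s • (x - k)) (𝓝[>] 0) (𝓝[closedOrthant n \ {k}] k) := by
    refine tendsto_nhdsWithin_iff.2 ⟨tendsto_segment k _, ?_⟩
    filter_upwards [self_mem_nhdsWithin, hle1] with s hs hs1
    refine ⟨?_, ?_⟩
    · exact convex_closedOrthant.add_smul_sub_mem hk hx ⟨(mem_Ioi.1 hs).le, hs1⟩
    · simp [(mem_Ioi.1 hs).ne', sub_ne_zero.2 hxk]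
  obtain ⟨s, hs, hs1, hs0⟩ := ((htend.eventually hev).and (hle1.and self_mem_nhdsWithin)).exists
  have hs0' : 0 < s := hs0
  obtain ⟨hb, -⟩ := H.value_segment hk1 hxv hs0'.le hs1
  refine ⟨s, hs0', hs1, ?_⟩
  rw [← EReal.coe_toReal (H.value_ne_top _) hb, ← EReal.coe_toReal hk2 hk1, ← EReal.coe_sub,
    ← EReal.coe_sub, ← EReal.coe_div, EReal.coe_lt_coe_iff, add_sub_cancel_left, norm_smul,
    inner_smul_right, Real.norm_of_nonneg hs0'.le, div_lt_iff₀ (mul_pos hs0' hd)] at hs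
  have e : ε / ‖x - k‖ * (s * ‖x - k‖) = s * ε := by field_simp
  rw [e] at hs
  linarith

/-- Directional first order expansion of a function with a gradient. -/
theorem hasDerivAt_segment {φ : EuclideanSpace ℝ (Fin n) → ℝ} (hφ : DifferentiableAt ℝ φ k)
    (d : EuclideanSpace ℝ (Fin n)) :
    HasDerivAt (fun s : ℝ => φ (k + s • d)) ⟪∇ φ k, d⟫_ℝ 0 := by
  have h1 : HasDerivAt (fun s : ℝ => k + s • d) d 0 := by
    simpa using ((hasDerivAt_id (0 : ℝ)).smul_const d).const_add k
  have h2 := hφ.hasGradientAt.hasFDerivAt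
  have h3 : k = k + (0 : ℝ) • d := by simp
  rw [h3] at h2
  refine (h2.comp_hasDerivAt (0 : ℝ) h1).congr_deriv ?_
  simp

theorem eventually_segment_le {φ : EuclideanSpace ℝ (Fin n) → ℝ} (hφ : DifferentiableAt ℝ φ k)
    (d : EuclideanSpace ℝ (Fin n)) {ε : ℝ} (hε : 0 < ε) :
    ∀ᶠ s in 𝓝[>] (0 : ℝ), φ (k + s • d) ≤ φ k + s * (⟪∇ φ k, d⟫_ℝ + ε) := by
  have h := (hasDerivAt_iff_tendsto_slope.1 (hasDerivAt_segment hφ d)).mono_left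
    (nhdsWithin_mono 0 fun t (ht : 0 < t) => ht.ne')
  filter_upwards [h.eventually_lt_const (show ⟪∇ φ k, d⟫_ℝ < ⟪∇ φ k, d⟫_ℝ + ε by linarith),
    self_mem_nhdsWithin] with s hs hs0
  have hs0' : 0 < s := hs0
  rw [slope_def_field, sub_zero, div_lt_iff₀ hs0', zero_smul, add_zero] at hs
  linarith

theorem Standing.isSupergradient_of_isLocalMax (H : M.Standing ν lam b)
    (hk : M.value k ≠ ⊥) {φ : EuclideanSpace ℝ (Fin n) → ℝ} (hφ : DifferentiableAt ℝ φ k)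
    (hmax : IsLocalMax (fun x => (M.value x).toReal - φ x) k) :
    M.IsSupergradient k (∇ φ k) := by
  refine H.isSupergradient_of_segments hk fun x _ _ ε hε => ?_
  have hle1 : ∀ᶠ s in 𝓝[>] (0 : ℝ), s ≤ 1 :=
    (Iic_mem_nhds one_pos : Iic (1 : ℝ) ∈ 𝓝 0) |> mem_nhdsWithin_of_mem_nhds
  obtain ⟨s, h1, h2, h3, h4⟩ := ((eventually_segment_le hφ (x - k) hε).and
    (((tendsto_segment k (x - k)).eventually hmax).and (hle1.and self_mem_nhdsWithin))).exists
  exact ⟨s, h4, h3, by linarith⟩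

/-- Touching from below bounds the value from below at `k - s d`, where `d = x - k`. Concavity at
the midpoint `k` of `k ± s d` turns this into an upper bound at `k + s d`, so a test function
touching from below also has a supergradient as its gradient. -/
theorem Standing.isSupergradient_of_isLocalMin (H : M.Standing ν lam b)
    (hV : ∀ x ∈ openOrthant n, M.value x ≠ ⊥) (hk : k ∈ openOrthant n)
    {φ : EuclideanSpace ℝ (Fin n) → ℝ} (hφ : DifferentiableAt ℝ φ k)
    (hmin : IsLocalMin (fun x => (M.value x).toReal - φ x) k) :
    M.IsSupergradient k (∇ φ k) := by
  refine H.isSupergradient_of_segments (hV k hk) fun x _ _ ε hε => ?_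
  have hle1 : ∀ᶠ s in 𝓝[>] (0 : ℝ), s ≤ 1 :=
    (Iic_mem_nhds one_pos : Iic (1 : ℝ) ∈ 𝓝 0) |> mem_nhdsWithin_of_mem_nhds
  have hψ : DifferentiableAt ℝ (fun y => -φ y) k := hφ.neg
  have hgrad : ∇ (fun y => -φ y) k = -∇ φ k := by
    simp only [gradient]
    rw [fderiv_fun_neg, map_neg]
  have hopen := isOpen_openOrthant.mem_nhds hk
  obtain ⟨s, h1, h2, h3, h4, h5, h6⟩ := ((eventually_segment_le hψ (-(x - k)) hε).and
    (((tendsto_segment k (-(x - k))).eventually hmin).and (hle1.and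
      (((tendsto_segment k (-(x - k))).eventually hopen).and
        (((tendsto_segment k (x - k)).eventually hopen).and self_mem_nhdsWithin))))).exists
  refine ⟨s, h6, h3, ?_⟩
  have hc := (H.value_concave (hV _ h5) (hV _ h4) (s := 1 / 2) (r := 1 / 2) (by norm_num)
    (by norm_num) (by norm_num)).2
  have e : (1 / 2 : ℝ) • (k + s • (x - k)) + (1 / 2 : ℝ) • (k + s • -(x - k)) = k := by
    rw [smul_neg, ← smul_add, add_add_add_comm, add_neg_cancel, add_zero, ← two_smul ℝ k, smul_smul]
    norm_num
  rw [e] at hc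
  rw [hgrad, inner_neg_neg] at h1
  linarith

/-- Monotonicity and the supergradient inequality give `V(k) ≤ V(k + eᵢ) ≤ V(k) + qᵢ`. -/
theorem Standing.mem_closedOrthant_of_isSupergradient (H : M.Standing ν lam b)
    (hk : k ∈ closedOrthant n) (hkv : M.value k ≠ ⊥) (hq : M.IsSupergradient k q) :
    q ∈ closedOrthant n := by
  intro i
  have h1 : M.value k ≤ M.value (k + EuclideanSpace.single i (1 : ℝ)) :=
    H.value_mono (by simpa using single_mem_closedOrthant i)
  have h2 := hq _ (closedOrthant_add hk (single_mem_closedOrthant i))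
    (ne_bot_of_le_ne_bot hkv h1)
  have h3 := EReal.toReal_le_toReal h1 hkv (H.value_ne_top _)
  rw [add_sub_cancel_left, EuclideanSpace.inner_single_right] at h2
  simp only [one_mul, conj_trivial] at h2
  linarith

/-- Homogeneity of the Hamiltonian, as a family of upper bounds depending continuously on the
scaling factor. -/
theorem exists_scaled_bound (hγ : 0 < M.γ) {h : ℝ}
    (hh : ∀ c ∈ closedOrthant n, M.FiniteUtility c →
      -⟪M.N c, q⟫_ℝ + M.realAggregateUtility c ≤ h) :
    ∃ ψ : ℝ → ℝ, ContinuousAt ψ 1 ∧ ψ 1 = h ∧ ∀ β : ℝ, 0 < β → ∀ c ∈ closedOrthant n,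
      M.FiniteUtility c → -(β * ⟪M.N c, q⟫_ℝ) + M.realAggregateUtility c ≤ ψ β := by
  by_cases hγ1 : M.γ = 1
  -- Substituting `β c` for `c` shifts the logarithmic utility by the constant `(∑ pᵢ) log β`.
  · refine ⟨fun β => h - (∑ i, M.p i) * Real.log β, ?_, by simp, fun β hβ c hc hcf => ?_⟩
    · exact continuousAt_const.sub (continuousAt_const.mul (Real.continuousAt_log one_ne_zero))
    · have h1 := hh (β • c) (closedOrthant_smul hβ.le hc) (finiteUtility_smul hcf hβ.ne')
      have h2 : M.realAggregateUtility (β • c) =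
          (∑ i, M.p i) * Real.log β + M.realAggregateUtility c := by
        simp only [realAggregateUtility, realUtility, if_pos hγ1, Finset.sum_mul,
          ← Finset.sum_add_distrib]
        refine Finset.sum_congr rfl fun i _ => ?_
        rw [PiLp.smul_apply, smul_eq_mul, Real.log_mul hβ.ne' (hcf hγ1.ge i)]
        ring
      rw [h2, map_smul, inner_smul_left] at h1
      simp only [conj_trivial] at h1
      linarith
  -- Substitute `β^{1/γ} c` for `c` and multiply by `β^{1-1/γ}`: the powers combine to `β` on the
  -- linear term and to 1 on the utility.
  · refine ⟨fun β => β ^ (1 - 1 / M.γ) * h, ?_, by simp, fun β hβ c hc hcf => ?_⟩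
    · exact (Real.continuousAt_rpow_const 1 _ (Or.inl one_ne_zero)).mul continuousAt_const
    · have hα : 0 < β ^ (1 / M.γ) := Real.rpow_pos_of_pos hβ _
      have h1 := hh (β ^ (1 / M.γ) • c) (closedOrthant_smul hα.le hc)
        (finiteUtility_smul hcf hα.ne')
      rw [realAggregateUtility_smul hγ1 hc hα.le, map_smul, inner_smul_left] at h1
      simp only [conj_trivial] at h1
      have h2 := mul_le_mul_of_nonneg_left h1 (Real.rpow_nonneg hβ.le (1 - 1 / M.γ))
      have e1 : β ^ (1 - 1 / M.γ) * β ^ (1 / M.γ) = β := by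
        rw [← Real.rpow_add hβ, sub_add_cancel, Real.rpow_one]
      have e2 : β ^ (1 - 1 / M.γ) * (β ^ (1 / M.γ)) ^ (1 - M.γ) = 1 := by
        rw [← Real.rpow_mul hβ.le, ← Real.rpow_add hβ]
        have : 1 - 1 / M.γ + 1 / M.γ * (1 - M.γ) = 0 := by field_simp; ring
        rw [this, Real.rpow_zero]
      calc _ = -(β ^ (1 - 1 / M.γ) * β ^ (1 / M.γ) * ⟪M.N c, q⟫_ℝ) +
            β ^ (1 - 1 / M.γ) * (β ^ (1 / M.γ)) ^ (1 - M.γ) * M.realAggregateUtility c := by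
              rw [e1, e2, one_mul]
        _ ≤ _ := by linarith

/-- Dynamic programming and the supergradient bound at `K(t)` leave an integral in which consumption
enters through `U(C(s))` and `⟨q, e^{(t-s)B} N C(s)⟩`. Positivity bounds the latter below by
`e^{-ν(t-s)}⟨q, N C(s)⟩`, so a pointwise Hamiltonian bound applies for any size of `C(s)`. -/
theorem Standing.value_le_of_isSupergradient (H : M.Standing ν lam b)
    (hkv : M.value k ≠ ⊥) (hq : M.IsSupergradient k q) (hq0 : q ∈ closedOrthant n) {t h : ℝ}
    (ht : 0 ≤ t) (hh : ∀ c ∈ closedOrthant n, M.FiniteUtility c →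
      -(Real.exp (-((M.ρ + ν) * t)) * ⟪M.N c, q⟫_ℝ) + M.realAggregateUtility c ≤ h) :
    (M.value k).toReal ≤ (1 - Real.exp (-M.ρ * t)) / M.ρ * h + Real.exp (-M.ρ * t) *
      ((M.value k).toReal + ⟪q, NormedSpace.exp (t • M.drift) k - k⟫_ℝ) := by
  refine le_of_forall_pos_le_add fun ε hε => ?_
  obtain ⟨C, hC, K, hK, hKt, hKv, hi, hf, hlt⟩ := H.exists_control_dpp hkv hε ht
  have h1 := hq _ hKt hKv
  rw [inner_sub_right, M.inner_capitalPath hC.1 hK q ht] at h1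
  have hNC : IntervalIntegrable (fun s => M.N (C s)) volume 0 t := by
    have := intervalIntegrable_of_admissible hC le_rfl ht
    exact ⟨M.N.integrable_comp this.1, M.N.integrable_comp this.2⟩
  have hi2 : IntervalIntegrable
      (fun s => ⟪q, NormedSpace.exp ((t - s) • M.drift) (M.N (C s))⟫_ℝ) volume 0 t := by
    simp only [← inner_exp_adjoint]
    refine intervalIntegrable_inner ?_ hNC
    have h1 : Continuous fun s : ℝ =>
        NormedSpace.exp ((t - s) • ContinuousLinearMap.adjoint M.drift) :=
      (continuous_exp_smul (ContinuousLinearMap.adjoint M.drift)).comp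
        (by fun_prop : Continuous fun s : ℝ => t - s)
    exact h1.clm_apply continuous_const
  have hcomp : (∫ s in (0 : ℝ)..t, (Real.exp (-M.ρ * s) * M.realAggregateUtility (C s) -
      Real.exp (-M.ρ * t) * ⟪q, NormedSpace.exp ((t - s) • M.drift) (M.N (C s))⟫_ℝ)) ≤
      ∫ s in (0 : ℝ)..t, Real.exp (-M.ρ * s) * h := by
    refine intervalIntegral.integral_mono_ae_restrict ht (hi.sub (hi2.const_mul _))
      ((by fun_prop : Continuous fun s => Real.exp (-M.ρ * s) * h).intervalIntegrable _ _) ?_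
    filter_upwards [ae_restrict_of_ae_restrict_of_subset
      (Icc_subset_Ici_self : Icc 0 t ⊆ Ici 0) hf, ae_restrict_mem measurableSet_Icc] with s hs hst
    have hCs := hC.2.1 s (mem_Ici.2 hst.1)
    have h2 := hh _ hCs hs
    have h3 := inner_nonneg_of_mem_closedOrthant hq0
      (exp_smul_apply_sub_mem_closedOrthant H.shift (sub_nonneg.2 hst.2) (H.N_nonneg _ hCs))
    rw [inner_sub_right, inner_smul_right] at h3
    have h4 := inner_nonneg_of_mem_closedOrthant (H.N_nonneg _ hCs) hq0
    rw [real_inner_comm (M.N (C s)) q] at h3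
    -- The single factor `e^{-(ρ+ν)t}` lies below the exact one for every `s` in `[0, t]`, so the
    -- same `h` serves for all `s`.
    have h5 : Real.exp (-M.ρ * s) * Real.exp (-((M.ρ + ν) * t)) ≤
        Real.exp (-M.ρ * t) * Real.exp (-(ν * (t - s))) := by
      rw [← Real.exp_add, ← Real.exp_add]
      apply Real.exp_le_exp.2
      nlinarith [mul_nonneg H.ρ_pos.le hst.1, mul_nonneg H.shift_nonneg hst.1]
    have h6 := mul_le_mul_of_nonneg_right h5 h4
    have h7 := mul_le_mul_of_nonneg_left h3 (Real.exp_pos (-M.ρ * t)).le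
    have h8 := mul_le_mul_of_nonneg_left h2 (Real.exp_pos (-M.ρ * s)).le
    linarith
  rw [intervalIntegral.integral_sub hi (hi2.const_mul _), intervalIntegral.integral_const_mul,
    intervalIntegral.integral_mul_const, integral_exp_neg_mul H.ρ_pos.ne'] at hcomp
  have h9 := mul_le_mul_of_nonneg_left h1 (Real.exp_pos (-M.ρ * t)).le
  rw [inner_sub_right]
  linarith

theorem tendsto_exp_smul_sub_div (B : EuclideanSpace ℝ (Fin n) →L[ℝ] EuclideanSpace ℝ (Fin n))
    (k q : EuclideanSpace ℝ (Fin n)) :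
    Tendsto (fun t : ℝ => ⟪q, NormedSpace.exp (t • B) k - k⟫_ℝ / t) (𝓝[>] 0) (𝓝 ⟪B k, q⟫_ℝ) := by
  have h := hasDerivAt_exp_smul_apply B k 0
  rw [exp_zero_smul_apply] at h
  have h1 := (innerSL ℝ q).hasFDerivAt.comp_hasDerivAt (0 : ℝ) h
  have h2 := (hasDerivAt_iff_tendsto_slope.1 h1).mono_left
    (nhdsWithin_mono 0 fun t (ht : 0 < t) => ht.ne')
  rw [real_inner_comm]
  refine h2.congr fun t => ?_
  simp only [slope_def_field, Function.comp, exp_zero_smul_apply, innerSL_apply_apply, sub_zero,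
    inner_sub_right]

/-- The subsolution inequality for supergradients, valid up to the boundary. -/
theorem Standing.rho_mul_value_le (H : M.Standing ν lam b)
    (hkv : M.value k ≠ ⊥) (hq : M.IsSupergradient k q) (hq0 : q ∈ closedOrthant n) {h : ℝ}
    (hh : ∀ c ∈ closedOrthant n, M.FiniteUtility c →
      -⟪M.N c, q⟫_ℝ + M.realAggregateUtility c ≤ h) :
    M.ρ * (M.value k).toReal ≤ ⟪M.drift k, q⟫_ℝ + h := by
  obtain ⟨ψ, hψ, hψ1, hle⟩ := exists_scaled_bound H.γ_pos hh
  have hρ := H.ρ_pos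
  have hβ : Tendsto (fun t : ℝ => ψ (Real.exp (-((M.ρ + ν) * t)))) (𝓝[>] 0) (𝓝 h) := by
    have hc : Continuous fun t : ℝ => Real.exp (-((M.ρ + ν) * t)) := by fun_prop
    have h1 := (hc.tendsto 0).mono_left (nhdsWithin_le_nhds (s := Ioi 0))
    simp only [mul_zero, neg_zero, Real.exp_zero] at h1
    rw [← hψ1]
    exact hψ.tendsto.comp h1
  have hexp : Tendsto (fun t : ℝ => Real.exp (-M.ρ * t)) (𝓝[>] 0) (𝓝 1) := by
    have hc : Continuous fun t : ℝ => Real.exp (-M.ρ * t) := by fun_prop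
    have h1 := (hc.tendsto 0).mono_left (nhdsWithin_le_nhds (s := Ioi 0))
    simpa using h1
  have hl := (tendsto_one_sub_exp_div M.ρ).mul_const (M.value k).toReal
  have hr := (((tendsto_one_sub_exp_div M.ρ).div_const M.ρ).mul hβ).add
    (hexp.mul (tendsto_exp_smul_sub_div M.drift k q))
  rw [div_self hρ.ne', one_mul, one_mul, add_comm h] at hr
  refine le_of_tendsto_of_tendsto hl hr ?_
  filter_upwards [self_mem_nhdsWithin] with t ht
  have ht' : 0 < t := ht
  have h1 := H.value_le_of_isSupergradient hkv hq hq0 ht'.le (hle _ (Real.exp_pos _))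
  have e : (1 - Real.exp (-M.ρ * t)) / t / M.ρ * ψ (Real.exp (-((M.ρ + ν) * t))) +
      Real.exp (-M.ρ * t) * (⟪q, NormedSpace.exp (t • M.drift) k - k⟫_ℝ / t) =
      ((1 - Real.exp (-M.ρ * t)) / M.ρ * ψ (Real.exp (-((M.ρ + ν) * t))) +
      Real.exp (-M.ρ * t) * ⟪q, NormedSpace.exp (t • M.drift) k - k⟫_ℝ) / t := by
    field_simp
  rw [e, div_mul_eq_mul_div]
  exact div_le_div_of_nonneg_right (by linarith) ht'.le

theorem tendsto_path_sub_div {τ : ℝ} (hτ : 0 < τ)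
    (hK : M.IsCapitalPath (Icc (-τ) 0) k (fun _ => c) K) (q : EuclideanSpace ℝ (Fin n)) :
    Tendsto (fun t : ℝ => ⟪q, K (-t) - k⟫_ℝ / t) (𝓝[>] 0) (𝓝 (-⟪q, M.drift k - M.N c⟫_ℝ)) := by
  have h0 : (0 : ℝ) ∈ Icc (-τ) 0 := ⟨by linarith, le_rfl⟩
  have hK0 : K 0 = k := by simpa using hK.2 0 h0
  -- The path is controlled only on `[-τ, 0]`; clamping time to this interval gives a velocity
  -- continuous on the whole line, whose primitive has a two-sided derivative at 0.
  set e : ℝ → ℝ := fun s => max (-τ) (min s 0) with he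
  have hec : Continuous e := by fun_prop
  have hem : ∀ s, e s ∈ Icc (-τ) 0 := fun s =>
    ⟨le_max_left _ _, max_le (by linarith) (min_le_right _ _)⟩
  have hes : ∀ s ∈ Icc (-τ) 0, e s = s := fun s hs => by
    simp only [he, min_eq_left hs.2, max_eq_right hs.1]
  have hKe : Continuous fun s => K (e s) := hK.1.comp_continuous hec hem
  have hvc : Continuous fun s => M.drift (K (e s)) - M.N c :=
    (M.drift.continuous.comp hKe).sub continuous_const
  have hd : HasDerivAt (fun s => ∫ r in (0 : ℝ)..s, (M.drift (K (e r)) - M.N c))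
      (M.drift k - M.N c) 0 := by
    have h1 := intervalIntegral.integral_hasDerivAt_right (hvc.intervalIntegrable 0 0)
      (hvc.stronglyMeasurableAtFilter volume (𝓝 0)) hvc.continuousAt
    rwa [hes 0 h0, hK0] at h1
  have h2 := (innerSL ℝ q).hasFDerivAt.comp_hasDerivAt (0 : ℝ) hd
  have h3 : Tendsto (fun t : ℝ => -t) (𝓝[>] 0) (𝓝[≠] 0) := by
    refine tendsto_nhdsWithin_iff.2 ⟨?_, ?_⟩
    · simpa using (continuous_neg.tendsto (0 : ℝ)).mono_left (nhdsWithin_le_nhds (s := Ioi 0))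
    · filter_upwards [self_mem_nhdsWithin] with t ht
      simpa using (mem_Ioi.1 ht).ne'
  have h4 := ((hasDerivAt_iff_tendsto_slope.1 h2).comp h3).neg
  rw [innerSL_apply_apply] at h4
  refine h4.congr' ?_
  have hle : ∀ᶠ s in 𝓝[>] (0 : ℝ), s ≤ τ :=
    (Iic_mem_nhds hτ : Iic τ ∈ 𝓝 (0 : ℝ)) |> mem_nhdsWithin_of_mem_nhds
  filter_upwards [self_mem_nhdsWithin, hle] with t ht htτ
  have ht' : 0 < t := ht
  have hmem : -t ∈ Icc (-τ) 0 := ⟨by linarith, by linarith⟩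
  have e1 : K (-t) - k = ∫ r in (0 : ℝ)..(-t), (M.drift (K (e r)) - M.N c) := by
    rw [hK.2 _ hmem, add_sub_cancel_left]
    refine intervalIntegral.integral_congr fun r hr => ?_
    rw [uIcc_of_ge hmem.2] at hr
    simp only [hes r ⟨by linarith [hr.1], hr.2⟩]
  rw [e1]
  simp only [Function.comp, slope_def_field, innerSL_apply_apply, intervalIntegral.integral_same,
    inner_zero_right, sub_zero]
  rw [div_neg, neg_neg]

/-- The supersolution inequality for supergradients, for the constant controls that can be used
just before reaching `k`. -/
theorem Standing.le_rho_mul_value (H : M.Standing ν lam b) (hkv : M.value k ≠ ⊥)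
    (hq : M.IsSupergradient k q) (hc : c ∈ closedOrthant n) (hcf : M.FiniteUtility c) {τ : ℝ}
    (hτ : 0 < τ) (hK : M.IsCapitalPath (Icc (-τ) 0) k (fun _ => c) K)
    (hpos : ∀ s ∈ Icc (-τ) 0, K s ∈ closedOrthant n) :
    ⟪M.drift k, q⟫_ℝ + (-⟪M.N c, q⟫_ℝ + M.realAggregateUtility c) ≤
      M.ρ * (M.value k).toReal := by
  have hρ := H.ρ_pos
  have hl := ((tendsto_one_sub_exp_div M.ρ).div_const M.ρ).mul_const (M.realAggregateUtility c)
  have hr := ((tendsto_one_sub_exp_div M.ρ).mul_const (M.value k).toReal).add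
    (tendsto_path_sub_div hτ hK q)
  rw [div_self hρ.ne', one_mul] at hl
  have hle : ∀ᶠ s in 𝓝[>] (0 : ℝ), s ≤ τ :=
    (Iic_mem_nhds hτ : Iic τ ∈ 𝓝 (0 : ℝ)) |> mem_nhdsWithin_of_mem_nhds
  have key := le_of_tendsto_of_tendsto hl hr (by
    filter_upwards [self_mem_nhdsWithin, hle] with t ht htτ
    have ht' : 0 < t := ht
    have hsub : Icc (-t) 0 ⊆ Icc (-τ) 0 := Icc_subset_Icc_left (by linarith)
    have hmem : -t ∈ Icc (-t) 0 := ⟨le_rfl, by linarith⟩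
    obtain ⟨h1, h2⟩ := H.le_value_of_path hkv ht'.le hc hcf
      ⟨hK.1.mono hsub, fun s hs => hK.2 s (hsub hs)⟩ fun s hs => hpos s (hsub hs)
    -- The value at the starting point `K (-t)` is now bounded below by dynamic programming and
    -- above by the supergradient.
    have h3 := hq _ (hpos _ (hsub hmem)) h1
    have e : (1 - Real.exp (-M.ρ * t)) / t * (M.value k).toReal + ⟪q, K (-t) - k⟫_ℝ / t =
        ((1 - Real.exp (-M.ρ * t)) * (M.value k).toReal + ⟪q, K (-t) - k⟫_ℝ) / t := by
      field_simp
    have e2 : (1 - Real.exp (-M.ρ * t)) / t / M.ρ * M.realAggregateUtility c =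
        (1 - Real.exp (-M.ρ * t)) / M.ρ * M.realAggregateUtility c / t := by
      field_simp
    rw [e, e2]
    exact div_le_div_of_nonneg_right (by linarith) ht'.le)
  rw [inner_sub_right] at key
  rw [real_inner_comm q (M.drift k), real_inner_comm q (M.N c)]
  linarith

end GrowthModel

/-! ### From supergradient inequalities to the Hamilton–Jacobi–Bellman equation. -/

namespace GrowthModel

variable {n : ℕ} {M : GrowthModel n} {k c q : EuclideanSpace ℝ (Fin n)}
  {ν lam : ℝ} {b : EuclideanSpace ℝ (Fin n)}

theorem coe_le_hamiltonian (hc : c ∈ closedOrthant n) (hcf : M.FiniteUtility c) :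
    ((-⟪M.N c, q⟫_ℝ + M.realAggregateUtility c : ℝ) : EReal) ≤ M.hamiltonian q := by
  rw [EReal.coe_add, ← aggregateUtility_eq_coe hcf]
  exact le_iSup₂ (f := fun c (_ : c ∈ closedOrthant n) =>
    ((-⟪M.N c, q⟫_ℝ : ℝ) : EReal) + M.aggregateUtility c) c hc

/-- The vector of ones has finite utility for every `γ`. -/
theorem hamiltonian_ne_bot : M.hamiltonian q ≠ ⊥ :=
  ne_bot_of_le_ne_bot (EReal.coe_ne_bot _) (coe_le_hamiltonian
    (c := WithLp.toLp 2 fun _ => 1) (fun _ => zero_le_one) fun _ _ => one_ne_zero)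

theorem coe_add_aggregateUtility_le (hp : ∀ i, 0 < M.p i) {r : ℝ}
    (h : M.FiniteUtility c → -⟪M.N c, q⟫_ℝ + M.realAggregateUtility c ≤ r) :
    ((-⟪M.N c, q⟫_ℝ : ℝ) : EReal) + M.aggregateUtility c ≤ (r : EReal) := by
  by_cases hcf : M.FiniteUtility c
  · rw [aggregateUtility_eq_coe hcf, ← EReal.coe_add]
    exact EReal.coe_le_coe_iff.2 (h hcf)
  · rw [aggregateUtility_eq_bot hp hcf, EReal.add_bot]
    exact bot_le

theorem Standing.coe_le_hamiltonian_of_isSupergradient (H : M.Standing ν lam b)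
    (hk : k ∈ closedOrthant n) (hkv : M.value k ≠ ⊥) (hq : M.IsSupergradient k q) :
    ((M.ρ * (M.value k).toReal - ⟪M.drift k, q⟫_ℝ : ℝ) : EReal) ≤ M.hamiltonian q := by
  by_cases htop : M.hamiltonian q = ⊤
  · rw [htop]; exact le_top
  have e := EReal.coe_toReal htop hamiltonian_ne_bot
  rw [← e]
  refine EReal.coe_le_coe_iff.2 ?_
  have := H.rho_mul_value_le hkv hq (H.mem_closedOrthant_of_isSupergradient hk hkv hq)
    (h := (M.hamiltonian q).toReal) fun c hc hcf => by
      rw [← EReal.coe_le_coe_iff, e]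
      exact coe_le_hamiltonian hc hcf
  linarith

/-- By continuity the backward solution stays in the open orthant for a short time, whatever `c` is.
This is why the full Hamiltonian appears in the interior. -/
theorem exists_path_to_interior (hk : k ∈ openOrthant n) (c : EuclideanSpace ℝ (Fin n)) :
    ∃ τ : ℝ, 0 < τ ∧ ∃ K, M.IsCapitalPath (Icc (-τ) 0) k (fun _ => c) K ∧
      ∀ s ∈ Icc (-τ) 0, K s ∈ closedOrthant n := by
  obtain ⟨K, hK, hK0, -⟩ := exists_forced_solution M.drift
    (continuous_const : Continuous fun _ : ℝ => -M.N c) k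
  have hev : ∀ᶠ s in 𝓝 (0 : ℝ), K s ∈ openOrthant n :=
    (hK 0).continuousAt (hK0.symm ▸ isOpen_openOrthant.mem_nhds hk)
  obtain ⟨ε, hε, hball⟩ := Metric.eventually_nhds_iff.1 hev
  refine ⟨ε / 2, by positivity, K, M.isCapitalPath_of_hasDerivAt continuous_const
    (fun t => by simpa [sub_eq_add_neg] using hK t) hK0, fun s hs =>
    openOrthant_subset_closedOrthant (hball ?_)⟩
  rw [Real.dist_eq, sub_zero, abs_of_nonpos hs.2]
  linarith [hs.1]

theorem Standing.hamiltonian_eq (H : M.Standing ν lam b) (hk : k ∈ openOrthant n)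
    (hkv : M.value k ≠ ⊥) (hq : M.IsSupergradient k q) :
    M.hamiltonian q = ((M.ρ * (M.value k).toReal - ⟪M.drift k, q⟫_ℝ : ℝ) : EReal) := by
  refine le_antisymm (iSup₂_le fun c hc => coe_add_aggregateUtility_le H.p_pos fun hcf => ?_)
    (H.coe_le_hamiltonian_of_isSupergradient (openOrthant_subset_closedOrthant hk) hkv hq)
  obtain ⟨τ, hτ, K, hK, hpos⟩ := exists_path_to_interior (M := M) hk c
  have := H.le_rho_mul_value hkv hq hc hcf hτ hK hpos
  linarith

theorem Standing.inwardHamiltonian_le (H : M.Standing ν lam b) (hkv : M.value k ≠ ⊥)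
    (hq : M.IsSupergradient k q) :
    M.inwardHamiltonian k q ≤
      ((M.ρ * (M.value k).toReal - ⟪M.drift k, q⟫_ℝ : ℝ) : EReal) := by
  refine iSup₂_le fun c hc => coe_add_aggregateUtility_le H.p_pos fun hcf => ?_
  obtain ⟨hc, C, ⟨-, -, K, hK, hKp⟩, τ, hτ, hCc⟩ := hc
  have hpath : M.IsCapitalPath (Icc (-τ) 0) k (fun _ => c) K := by
    refine ⟨hK.1.mono Icc_subset_Iic_self, fun s hs => ?_⟩
    rw [hK.2 s hs.2]
    congr 1
    refine intervalIntegral.integral_congr_ae (Eventually.of_forall fun r hr => ?_)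
    rw [uIoc_of_ge hs.2] at hr
    rw [hCc r ⟨hs.1.trans_lt hr.1, hr.2⟩]
  have := H.le_rho_mul_value hkv hq hc hcf hτ hpath fun s hs => hKp s hs.2
  linarith

theorem Standing.concaveOn_toReal_value (H : M.Standing ν lam b)
    (hV : ∀ k ∈ openOrthant n, M.value k ≠ ⊥) :
    ConcaveOn ℝ (openOrthant n) fun k => (M.value k).toReal :=
  ⟨convex_openOrthant, fun x hx y hy _ _ ha hb hab =>
    (H.value_concave (hV x hx) (hV y hy) ha hb hab).2⟩

/-- Both kinds of test function have supergradients as gradients, and at a supergradient the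
equation holds with equality, so all four inequalities follow at once. Continuity comes from
concavity on an open set in finite dimension. -/
theorem Standing.isBilateralViscositySolution (H : M.Standing ν lam b)
    (hV : ∀ k ∈ openOrthant n, M.value k ≠ ⊥) :
    M.IsBilateralViscositySolution fun k => (M.value k).toReal := by
  have hcont := (H.concaveOn_toReal_value hV).continuousOn isOpen_openOrthant
  have hdiff : ∀ φ : EuclideanSpace ℝ (Fin n) → ℝ, ContDiffOn ℝ 1 φ (openOrthant n) →
      ∀ k ∈ openOrthant n, DifferentiableAt ℝ φ k := fun φ hφ k hk =>
    (hφ.differentiableOn one_ne_zero).differentiableAt (isOpen_openOrthant.mem_nhds hk)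
  have hjb_eq : ∀ k ∈ openOrthant n, ∀ q, M.IsSupergradient k q →
      M.hjb k (M.value k).toReal q = 0 := fun k hk q hq => by
    rw [hjb, H.hamiltonian_eq hk (hV k hk) hq, ← EReal.coe_sub, sub_self, EReal.coe_zero]
  have opp_eq : ∀ k ∈ openOrthant n, ∀ q, M.IsSupergradient k q →
      M.oppositeHjb k (M.value k).toReal q = 0 := fun k hk q hq => by
    rw [oppositeHjb, H.hamiltonian_eq hk (hV k hk) hq, ← EReal.coe_add, ← EReal.coe_zero]
    congr 1; ring
  have hmax := fun φ hφ k hk => H.isSupergradient_of_isLocalMax (hV k hk) (hdiff φ hφ k hk)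
  have hmin := fun φ hφ k hk => H.isSupergradient_of_isLocalMin hV hk (hdiff φ hφ k hk)
  exact ⟨⟨⟨hcont, fun φ hφ k hk h => (hjb_eq k hk _ (hmax φ hφ k hk h)).le⟩,
      ⟨hcont, fun φ hφ k hk h => (hjb_eq k hk _ (hmin φ hφ k hk h)).ge⟩⟩,
    ⟨hcont, fun φ hφ k hk h => (opp_eq k hk _ (hmax φ hφ k hk h)).le⟩,
    ⟨hcont, fun φ hφ k hk h => (opp_eq k hk _ (hmin φ hφ k hk h)).ge⟩⟩

end GrowthModel

theorem mainTheorem2 (n : ℕ) (hn : 2 ≤ n) (M : GrowthModel n)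
    (hA : ∀ i, 0 < M.A i) (hp : ∀ i, 0 < M.p i) (hρ : 0 < M.ρ) (hγ : 0 < M.γ)
    -- `(e^{tL})` is a positive semigroup
    (hL : ∀ t : ℝ, 0 ≤ t → ∀ x ∈ closedOrthant n, NormedSpace.exp (t • M.L) x ∈ closedOrthant n)
    -- `N` preserves positivity and `N eᵢ ≠ 0`
    (hN : ∀ x ∈ closedOrthant n, M.N x ∈ closedOrthant n)
    (hNe : ∀ i, M.N (EuclideanSpace.single i 1) ≠ 0)
    -- a strictly positive eigenvector of `(L + A)ᵀ`, with eigenvalue `lam > 0`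
    (lam : ℝ) (hlam : 0 < lam) (b : EuclideanSpace ℝ (Fin n)) (hb : b ∈ openOrthant n)
    (hbeig : ContinuousLinearMap.adjoint M.drift b = lam • b)
    (hρlam : lam * (1 - M.γ) < M.ρ)
    -- in the case `γ > 1`, the value function is not identically `-∞`
    (hV : 1 < M.γ → ∃ k ∈ closedOrthant n, M.value k ≠ ⊥) :
    -- `V` is finite in the open orthant, and a bilateral viscosity solution there
    (∀ k ∈ openOrthant n, M.value k ≠ ⊥ ∧ M.value k ≠ ⊤) ∧
    M.IsBilateralViscositySolution (fun k => (M.value k).toReal) ∧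
    -- the equation for elements of the superdifferential
    (∀ k ∈ openOrthant n, ∀ q ∈ superdifferential (closedOrthant n) M.value k,
      (M.ρ : EReal) * M.value k
        = ((inner ℝ (M.drift k) q : ℝ) : EReal) + M.hamiltonian q) ∧
    -- the inequalities at the boundary
    (∀ k ∈ frontier (closedOrthant n), ∀ q ∈ superdifferential (closedOrthant n) M.value k,
      (M.ρ : EReal) * M.value k - ((inner ℝ (M.drift k) q : ℝ) : EReal)
          - M.hamiltonian q ≤ 0 ∧
      -((M.ρ : EReal) * M.value k) + ((inner ℝ (M.drift k) q : ℝ) : EReal)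
          + M.inwardHamiltonian k q ≤ 0) := by
  obtain ⟨ν, hν0, hν⟩ := M.exists_shift hA hL
  have H : M.Standing ν lam b :=
    ⟨hp, hρ, hγ, hν0, hν, hN, hNe, hlam, hb, hbeig, hρlam⟩
  have hfin : ∀ k ∈ openOrthant n, M.value k ≠ ⊥ := fun k hk => H.value_ne_bot hV hk
  refine ⟨fun k hk => ⟨hfin k hk, H.value_ne_top k⟩, H.isBilateralViscositySolution hfin,
    fun k hk q hq => ?_, fun k hk q hq => ?_⟩
  · have hsg := H.isSupergradient_of_mem_superdifferential
      (openOrthant_subset_closedOrthant hk) hq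
    rw [H.hamiltonian_eq hk (hfin k hk) hsg, ← EReal.coe_add, add_sub_cancel, EReal.coe_mul,
      EReal.coe_toReal (H.value_ne_top k) (hfin k hk)]
  · have hkc := isClosed_closedOrthant.frontier_subset hk
    have hsg := H.isSupergradient_of_mem_superdifferential hkc hq
    have h1 := H.coe_le_hamiltonian_of_isSupergradient hkc hq.1 hsg
    have h2 := H.inwardHamiltonian_le hq.1 hsg
    rw [← EReal.coe_toReal (H.value_ne_top k) hq.1, ← EReal.coe_mul, ← EReal.coe_sub,
      ← EReal.coe_neg, ← EReal.coe_add]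
    refine ⟨EReal.sub_nonpos.2 h1, ?_⟩
    calc _ ≤ ((-(M.ρ * (M.value k).toReal) + ⟪M.drift k, q⟫_ℝ : ℝ) : EReal) +
          ((M.ρ * (M.value k).toReal - ⟪M.drift k, q⟫_ℝ : ℝ) : EReal) := by gcongr
      _ = 0 := by
        rw [← EReal.coe_add, ← EReal.coe_zero]
        congr 1; ring
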